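/- Let $n\ge 1$, and let $(V,b)$ be a symplectic space over $\mathbb F_2$ of dimension $2n$: $b$ is a nondegenerate bilinear form on $V$ with $b(v,v)=0$ for all $v$. Let $\mathrm{Sp}(V)$ be its group of isometries. Fix a quadratic form $q\colon V\to\mathbb F_2$ with $q(v+w)=q(v)+q(w)+b(v,w)$ for all $v,w$, and for $A\in \mathrm{Sp}(V)$ let $SA\colon V\to\mathbb F_2$ be the linear functional $v\mapsto q(v)+q(Av)$. Let $M_V=V\oplus\mathbb F_2$, on which $\mathrm{Sp}(V)$ acts by $A\cdot(v,\lambda)=(Av,(SA)(v)+\lambda)$, and let $G_V=M_V\rtimes \mathrm{Sp}(V)$, with elements written $(x,A)$. An involution of a group is an element whose square is the identity (the identity itself is included). For an involution $A\in \mathrm{Sp}(V)$ let $\mathcal S_A$ be the set of conjugacy classes of $G_V$ that are represented by involutions of the form $(x,A)$, $x\in M_V$; let $D(A)=\operatorname{rank}(A+\mathrm{Id})$, and let $\alpha(A)\in\{0,1\}$ be the rank of the linear functional $v\mapsto b(v,Av)$. Let $C(A)$ be the centralizer of $A$ in $\mathrm{Sp}(V)$. (1) Suppose that $V=U\oplus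 W$ with $W^\perp=U$ and that $A=K\oplus\mathrm{Id}_W\in \mathrm{Sp}(V)$, where $K\colon U\to U$ is an involution with $\operatorname{im}(K+\mathrm{Id}_U)=\ker(K+\mathrm{Id}_U)$. Let $\pi_U,\pi_W$ be the projections of $V$ onto $U$ and $W$. Then: (a) For all $P\in C(A)$ and $w\in W$ there is $u\in U$ with $Au+u=\pi_U(Pw)$, and $$P\cdot(w,\lambda)=\bigl(\pi_W(Pw),\ \lambda+(SP)(w)+(SA)(u)\bigr),$$ for any such $u$, is a well-defined action of $C(A)$ on $W\oplus\mathbb F_2$. Sending $(w,\lambda)$ to the conjugacy class of $((w,\lambda),A)$ induces a bijection from the set of orbits of this action to $\mathcal S_A$. (b) If $W=0$, then $|\mathcal S_A|=2$. (c) If $W\ne0$ and $\alpha(A)=0$, then $|\mathcal S_A|=4$. (d) If $W\neq 0$, $\alpha(A)=1$, and there are $u_1,u_2\in U$ with $Ku_1=u_2$ and $b(u_1,u_2)=1$, then $|\mathcal S_A|=3$. (2) Let $A\in \mathrm{Sp}(V)$ be any involution. Then $|\mathcal S_A|=4$ if $A=\mathrm{Id}$; $|\mathcal S_A|=2$ if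 $D(A)=\tfrac12\dim V$; $|\mathcal S_A|=3$ if $\alpha(A)=1$ and $0<D(A)<\tfrac12\dim V$; and $|\mathcal S_A|=4$ if $\alpha(A)=0$ and $0<D(A)<\tfrac12\dim V$. (3) The group $G_V$ has exactly $5n+1$ conjugacy classes of involutions. -/

import Mathlib

namespace SympInv

variable {V : Type*} [AddCommGroup V] [Module (ZMod 2) V]

/-- The isometry group of a bilinear form `b` on an `𝔽₂`-vector space. It is written `Sp(V)` when
`b` is nondegenerate and alternating. -/
def Sp (b : LinearMap.BilinForm (ZMod 2) V) : Subgroup (V ≃ₗ[ZMod 2] V) where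
  carrier := {A | ∀ v w, b (A v) (A w) = b v w}
  mul_mem' {A B} hA hB v w := by
    exact (hA (B v) (B w)).trans (hB v w)
  one_mem' _ _ := rfl
  inv_mem' {A} hA v w := by
    have h : b (A (A⁻¹ v)) (A (A⁻¹ w)) = b (A⁻¹ v) (A⁻¹ w) := hA (A⁻¹ v) (A⁻¹ w)
    have e : ∀ x, A (A⁻¹ x) = x := fun x => A.apply_symm_apply x
    rw [e, e] at h
    exact h.symm

/-- A semi-norm of `b`: a quadratic form `q` with `q(v+w) = q(v) + q(w) + b(v,w)`. -/
structure SemiNorm (b : LinearMap.BilinForm (ZMod 2) V) where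
  toQuad : QuadraticForm (ZMod 2) V
  map_add' : ∀ v w, toQuad (v + w) = toQuad v + toQuad w + b v w

variable {b : LinearMap.BilinForm (ZMod 2) V}

/-- The linear functional `S_q A : v ↦ q(v) + q(Av)`. -/
def sqForm (q : SemiNorm b) (A : Sp b) : V →ₗ[ZMod 2] ZMod 2 where
  toFun v := q.toQuad v + q.toQuad (A.1 v)
  map_add' v w := by
    have h := A.2 v w
    have two : ∀ x : ZMod 2, x + x = 0 := by decide
    rw [map_add A.1, q.map_add', q.map_add', h]
    linear_combination two (b v w)
  map_smul' c v := by
    have hc : ∀ x : ZMod 2, x * x = x := by decide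
    rw [map_smul A.1, QuadraticMap.map_smul, QuadraticMap.map_smul, hc]
    simp [mul_add]

theorem sqForm_mul (q : SemiNorm b) (A B : Sp b) (v : V) :
    sqForm q (A * B) v = sqForm q B v + sqForm q A (B.1 v) := by
  have two : ∀ x : ZMod 2, x + x = 0 := by decide
  change q.toQuad v + q.toQuad (A.1 (B.1 v)) =
    (q.toQuad v + q.toQuad (B.1 v)) + (q.toQuad (B.1 v) + q.toQuad (A.1 (B.1 v)))
  linear_combination - two (q.toQuad (B.1 v))

theorem sqForm_one (q : SemiNorm b) (v : V) : sqForm q 1 v = 0 := by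
  have two : ∀ x : ZMod 2, x + x = 0 := by decide
  exact two (q.toQuad v)

/-- The underlying map of `A` acting on `M_V = V ⊕ 𝔽₂` by `A·(v,t) = (Av, (S_q A)(v) + t)`. -/
def actFun (q : SemiNorm b) (A : Sp b) (x : V × ZMod 2) : V × ZMod 2 :=
  (A.1 x.1, sqForm q A x.1 + x.2)

theorem actFun_mul (q : SemiNorm b) (A B : Sp b) (x : V × ZMod 2) :
    actFun q (A * B) x = actFun q A (actFun q B x) := by
  refine Prod.ext rfl ?_
  change sqForm q (A * B) x.1 + x.2 = sqForm q A (B.1 x.1) + (sqForm q B x.1 + x.2)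
  rw [sqForm_mul]
  ring

theorem actFun_one (q : SemiNorm b) (x : V × ZMod 2) : actFun q 1 x = x := by
  refine Prod.ext rfl ?_
  change sqForm q 1 x.1 + x.2 = x.2
  rw [sqForm_one, zero_add]

/-- The action of `A` as an automorphism of the additive group `M_V = V ⊕ 𝔽₂`. -/
def actAdd (q : SemiNorm b) (A : Sp b) : (V × ZMod 2) ≃+ (V × ZMod 2) where
  toFun := actFun q A
  invFun := actFun q A⁻¹
  left_inv x := by rw [← actFun_mul, inv_mul_cancel, actFun_one]
  right_inv x := by rw [← actFun_mul, mul_inv_cancel, actFun_one]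
  map_add' x y := by
    refine Prod.ext (map_add A.1 x.1 y.1) ?_
    change sqForm q A (x.1 + y.1) + (x.2 + y.2) = (sqForm q A x.1 + x.2) + (sqForm q A y.1 + y.2)
    rw [map_add]
    ring

/-- The representation `M_V` of `Sp(V)`, with `M_V = V ⊕ 𝔽₂` written multiplicatively. -/
def rep (q : SemiNorm b) : Sp b →* MulAut (Multiplicative (V × ZMod 2)) where
  toFun A := AddEquiv.toMultiplicative (actAdd q A)
  map_one' := by
    refine MulEquiv.ext fun x => ?_
    exact congrArg Multiplicative.ofAdd (actFun_one q x.toAdd)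
  map_mul' A B := by
    refine MulEquiv.ext fun x => ?_
    exact congrArg Multiplicative.ofAdd (actFun_mul q A B x.toAdd)

/-- The group `G_V = M_V ⋊ Sp(V)`. -/
abbrev GV (q : SemiNorm b) : Type _ :=
  Multiplicative (V × ZMod 2) ⋊[rep q] Sp b

/-- The element `(x, A)` of `G_V`. -/
def pair (q : SemiNorm b) (x : V × ZMod 2) (A : Sp b) : GV q :=
  ⟨Multiplicative.ofAdd x, A⟩

/-- The conjugacy classes of involutions of a group. Here, and everywhere below, an involution is
an element with square `1`; the identity counts as one. -/
def involutionClasses (G : Type*) [Group G] : Set (ConjClasses G) :=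
  {c | ∃ g : G, g * g = 1 ∧ ConjClasses.mk g = c}

/-- The set `S_A` of conjugacy classes of `G_V` represented by involutions `(x, A)`. -/
def classesOver (q : SemiNorm b) (A : Sp b) : Set (ConjClasses (GV q)) :=
  {c | ∃ x : V × ZMod 2, pair q x A * pair q x A = 1 ∧ ConjClasses.mk (pair q x A) = c}

/-- The Dickson invariant `D(A)`, the rank of `A + Id`. -/
noncomputable def dickson (A : Sp b) : ℕ :=
  Module.finrank (ZMod 2) (LinearMap.range ((A.1 : V →ₗ[ZMod 2] V) + LinearMap.id))

/-- For an involution `A`, the linear functional `v ↦ b(v, Av)`. -/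
def alphaForm (hb : b.IsAlt) (A : Sp b) (hA : A * A = 1) : V →ₗ[ZMod 2] ZMod 2 where
  toFun v := b v (A.1 v)
  map_add' v w := by
    have two : ∀ x : ZMod 2, x + x = 0 := by decide
    have hAA : A.1 (A.1 w) = w := by
      have h := congrArg (fun B : Sp b => B.1 w) hA
      exact h
    have h1 : b v (A.1 w) = b (A.1 v) w := by rw [← A.2 v (A.1 w), hAA]
    have h2 : -b (A.1 v) w = b w (A.1 v) := hb.neg_eq (A.1 v) w
    simp only [map_add, LinearMap.add_apply]
    linear_combination h1 - h2
  map_smul' c v := by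
    have hc : ∀ x y : ZMod 2, x * (x * y) = x * y := by decide
    simp [hc]

/-- The invariant `α(A)` of an involution `A`, the rank of `v ↦ b(v, Av)`. -/
noncomputable def alpha (hb : b.IsAlt) (A : Sp b) (hA : A * A = 1) : ℕ :=
  Module.finrank (ZMod 2) (LinearMap.range (alphaForm hb A hA))

/-- `V = U ⊕ W` with `W^⊥ = U`, and `A = K ⊕ Id_W` for an involution `K` of `U` such that
`im (K + Id_U) = ker (K + Id_U)`. -/
structure Splits (A : Sp b) (U W : Submodule (ZMod 2) V) (K : U →ₗ[ZMod 2] U) : Prop where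
  compl : IsCompl U W
  perp : b.orthogonal W = U
  onU : ∀ u : U, A.1 (u : V) = (K u : V)
  onW : ∀ w : W, A.1 (w : V) = (w : V)
  invol : ∀ u : U, K (K u) = u
  exact : LinearMap.range (K + LinearMap.id) = LinearMap.ker (K + LinearMap.id)

end SympInv

open SympInv

namespace SympInv

variable {V : Type*} [AddCommGroup V] [Module (ZMod 2) V]
variable {b : LinearMap.BilinForm (ZMod 2) V}

/-! For an involution `A` the operator `N = A + 1` is self-adjoint with `N² = 0`, so `im N ≤ ker N =
(im N)^⊥`, with equality exactly when `D(A)` is half the dimension. An element `((v, t), A)` is an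
involution iff `N v = 0`. Writing `t = q(v) + s` removes `q` from conjugation over `A`: `(v, s)` is
conjugate to `(B v + N y, s + b(y, N y))` for `B` commuting with `A` and any `y` (`cls_eq_iff`).

Vectors `v ∈ im N` can be moved to `0`, where `s` is a full invariant: two classes. The vectors of
`ker N ∖ im N` form one orbit of `C(A)`, by transvections along `ker N` (`exists_commute_apply_eq`).
If this set is nonempty, it contributes two more classes when `b(y, N y)` is identically zero and
one when it is not. This gives the counts 2, 4 and 3.

For the total, `(D, α)` classifies the involutions of `Sp(V)` (`exists_conj`): the symmetric form
`b(x, N y)` is diagonal if `α = 1` and a sum of hyperbolic planes if `α = 0`, and Witt's theorem for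
isotropic families matches two normal forms of the same shape. So `D` runs over `1, …, n` when `α =
1` and over the even numbers up to `n` when `α = 0`, contributing `3n - 1` and `2n + 2` classes. -/

theorem zmod_two_cases : ∀ x : ZMod 2, x = 0 ∨ x = 1 := by decide

theorem add_eq_zero_iff_eq_of_char_two (v w : V) : v + w = 0 ↔ v = w := by
  rw [add_eq_zero_iff_eq_neg, neg_eq_of_add_eq_zero_left (ZModModule.add_self w)]

theorem add_add_self (v w : V) : v + w + w = v := by
  rw [add_assoc, ZModModule.add_self, add_zero]

theorem form_comm (hb : b.IsAlt) (x y : V) : b x y = b y x := by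
  rw [← hb.neg_eq, ZModModule.neg_eq_self]

/-! ### Square-zero self-adjoint operators -/

/-- A square-zero operator that is self-adjoint for `b`. -/
structure IsSqZeroSelfAdj (b : LinearMap.BilinForm (ZMod 2) V) (N : V →ₗ[ZMod 2] V) : Prop where
  selfAdj : ∀ x y, b (N x) y = b x (N y)
  sqZero : ∀ x, N (N x) = 0

namespace IsSqZeroSelfAdj

variable {N : V →ₗ[ZMod 2] V}

/-- The involution `1 + N` of `Sp(V)`. -/
def toSp (h : IsSqZeroSelfAdj b N) : Sp b :=
  ⟨LinearEquiv.ofInvolutive (LinearMap.id + N) (fun x => by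
      simp only [LinearMap.add_apply, LinearMap.id_apply, map_add, h.sqZero, add_zero]
      rw [add_add_self]), fun v w => by
    change b (v + N v) (w + N w) = b v w
    have e : b (N v) (N w) = 0 := by rw [h.selfAdj, h.sqZero, map_zero]
    simp only [map_add, LinearMap.add_apply, e, h.selfAdj, add_zero]
    rw [add_assoc, ZModModule.add_self, add_zero]⟩

@[simp] theorem toSp_apply (h : IsSqZeroSelfAdj b N) (x : V) : h.toSp.1 x = x + N x := rfl

theorem toSp_mul_self (h : IsSqZeroSelfAdj b N) : h.toSp * h.toSp = 1 := by
  refine Subtype.ext (LinearEquiv.ext fun x => ?_)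
  change (x + N x) + N (x + N x) = x
  rw [map_add, h.sqZero, add_zero, add_add_self]

theorem apply_range_orthogonal_ker (h : IsSqZeroSelfAdj b N) {x y : V} (hx : N x = 0) :
    b x (N y) = 0 := by
  rw [← h.selfAdj, hx, map_zero, LinearMap.zero_apply]

theorem ker_eq_orthogonal (hnd : b.Nondegenerate) (h : IsSqZeroSelfAdj b N) :
    LinearMap.ker N = b.orthogonal (LinearMap.range N) := by
  ext x
  rw [LinearMap.mem_ker, LinearMap.BilinForm.mem_orthogonal_iff]
  constructor
  · rintro hx _ ⟨y, rfl⟩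
    change b (N y) x = 0
    rw [h.selfAdj, hx, map_zero]
  · intro hx
    refine hnd.2 _ fun y => ?_
    rw [← h.selfAdj]
    exact hx _ ⟨y, rfl⟩

theorem orthogonal_ker [FiniteDimensional (ZMod 2) V] (hnd : b.Nondegenerate) (hb : b.IsAlt)
    (h : IsSqZeroSelfAdj b N) : b.orthogonal (LinearMap.ker N) = LinearMap.range N := by
  rw [h.ker_eq_orthogonal hnd, LinearMap.BilinForm.orthogonal_orthogonal hnd hb.isRefl]

theorem range_le_ker (h : IsSqZeroSelfAdj b N) : LinearMap.range N ≤ LinearMap.ker N := by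
  rintro _ ⟨y, rfl⟩
  exact h.sqZero y

theorem two_mul_finrank_range_le [FiniteDimensional (ZMod 2) V] (h : IsSqZeroSelfAdj b N) :
    2 * Module.finrank (ZMod 2) (LinearMap.range N) ≤ Module.finrank (ZMod 2) V := by
  have h1 := LinearMap.finrank_range_add_finrank_ker N
  have h2 := Submodule.finrank_mono h.range_le_ker
  omega

/-- Rank-nullity, given that the range already lies in the kernel. -/
theorem two_mul_finrank_range_eq_iff [FiniteDimensional (ZMod 2) V] (h : IsSqZeroSelfAdj b N) :
    2 * Module.finrank (ZMod 2) (LinearMap.range N) = Module.finrank (ZMod 2) V ↔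
      LinearMap.ker N = LinearMap.range N := by
  have h1 := LinearMap.finrank_range_add_finrank_ker N
  constructor
  · intro h2
    exact (Submodule.eq_of_le_of_finrank_eq h.range_le_ker (by omega)).symm
  · intro h2
    rw [h2] at h1
    omega

end IsSqZeroSelfAdj

/-! ### Transvections -/

/-- The operator `x ↦ b(x, c) c`. -/
def rankOne (b : LinearMap.BilinForm (ZMod 2) V) (c : V) : V →ₗ[ZMod 2] V :=
  (b.flip c).smulRight c

@[simp] theorem rankOne_apply (c x : V) : rankOne b c x = b x c • c := rfl

theorem isSqZeroSelfAdj_rankOne (hb : b.IsAlt) (c : V) : IsSqZeroSelfAdj b (rankOne b c) where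
  selfAdj x y := by
    simp only [rankOne_apply, map_smul, LinearMap.smul_apply, smul_eq_mul]
    rw [form_comm hb c y, mul_comm]
  sqZero x := by simp [hb.self_eq_zero]

/-- The transvection `x ↦ x + b(x, c) c`. -/
def transvection (hb : b.IsAlt) (c : V) : Sp b := (isSqZeroSelfAdj_rankOne hb c).toSp

@[simp] theorem transvection_apply (hb : b.IsAlt) (c x : V) :
    (transvection hb c).1 x = x + b x c • c := rfl

theorem transvection_add_apply (hb : b.IsAlt) {v w : V} (h : b v w = 1) :
    (transvection hb (v + w)).1 v = w := by
  simp only [transvection_apply, map_add, hb.self_eq_zero, h, zero_add, one_smul]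
  rw [← add_assoc, ZModModule.add_self, zero_add]

/-- Two vectors of a subspace `L` outside its radical are related by at most two transvections
along vectors of `L`. -/
theorem exists_transvections_apply_eq (hb : b.IsAlt) {L : Submodule (ZMod 2) V} {v w : V}
    (hv : v ∈ L) (hw : w ∈ L) (hv' : ∃ x ∈ L, b v x ≠ 0) (hw' : ∃ x ∈ L, b w x ≠ 0) :
    ∃ c ∈ L, ∃ d ∈ L, (transvection hb c * transvection hb d).1 v = w := by
  -- An intermediate vector `x` pairing to `1` with both ends gives the route `v → x → w`. If `x`
  -- pairs only with `v` and `y` only with `w`, then `x + y` serves.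
  have key : ∃ x ∈ L, b v x = 1 ∧ b x w = 1 := by
    obtain ⟨x, hx, hvx⟩ := hv'
    obtain ⟨y, hy, hwy⟩ := hw'
    replace hvx := (zmod_two_cases _).resolve_left hvx
    replace hwy := (zmod_two_cases _).resolve_left hwy
    rw [form_comm hb] at hwy
    rcases zmod_two_cases (b x w) with h1 | h1
    · rcases zmod_two_cases (b v y) with h2 | h2
      · refine ⟨x + y, L.add_mem hx hy, ?_, ?_⟩ <;> simp [*]
      · exact ⟨y, hy, h2, hwy⟩
    · exact ⟨x, hx, hvx, h1⟩
  obtain ⟨x, hx, h1, h2⟩ := key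
  refine ⟨x + w, L.add_mem hx hw, v + x, L.add_mem hv hx, ?_⟩
  change (transvection hb (x + w)).1 ((transvection hb (v + x)).1 v) = w
  rw [transvection_add_apply hb h1, transvection_add_apply hb h2]

theorem transvection_apply_of_orthogonal (hb : b.IsAlt) {c x : V} (h : b x c = 0) :
    (transvection hb c).1 x = x := by
  simp [h]

/-! ### The operator `A + 1`, its invariants and the centralizer -/

/-- The nilpotent part `A + 1` of an element of `Sp(V)`. -/
def nilPart (A : Sp b) : V →ₗ[ZMod 2] V := (A.1 : V →ₗ[ZMod 2] V) + LinearMap.id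

theorem nilPart_apply (A : Sp b) (x : V) : nilPart A x = A.1 x + x := rfl

theorem apply_eq_add_nilPart (A : Sp b) (x : V) : A.1 x = x + nilPart A x := by
  rw [nilPart_apply, add_comm, add_add_self]

theorem nilPart_eq_zero_iff (A : Sp b) (x : V) : nilPart A x = 0 ↔ A.1 x = x :=
  add_eq_zero_iff_eq_of_char_two _ _

theorem nilPart_toSp {N : V →ₗ[ZMod 2] V} (h : IsSqZeroSelfAdj b N) : nilPart h.toSp = N := by
  ext x
  rw [nilPart_apply, h.toSp_apply, add_comm, ← add_assoc, ZModModule.add_self, zero_add]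

theorem apply_apply_of_mul_self {A : Sp b} (hA : A * A = 1) (x : V) : A.1 (A.1 x) = x :=
  congrArg (fun B : Sp b => B.1 x) hA

theorem isSqZeroSelfAdj_nilPart {A : Sp b} (hA : A * A = 1) : IsSqZeroSelfAdj b (nilPart A) where
  selfAdj x y := by
    simp only [nilPart_apply, map_add, LinearMap.add_apply]
    rw [← A.2 x (A.1 y), apply_apply_of_mul_self hA]
  sqZero x := by
    simp only [nilPart_apply, map_add, apply_apply_of_mul_self hA]
    rw [add_comm x, ZModModule.add_self]

/-- Conjugating the transvection along `c` by an isometry gives the one along `A c`, and here `A c =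
c`. -/
theorem transvection_commute (hb : b.IsAlt) {A : Sp b} {c : V}
    (hc : c ∈ LinearMap.ker (nilPart A)) : Commute (transvection hb c) A := by
  refine Subtype.ext (LinearEquiv.ext fun x => ?_)
  have hc' : A.1 c = c := (nilPart_eq_zero_iff A c).1 hc
  change A.1 x + b (A.1 x) c • c = A.1 (x + b x c • c)
  rw [map_add, map_smul, hc']
  congr 2
  conv_lhs => rw [← hc', A.2]

theorem alphaForm_apply (hb : b.IsAlt) {A : Sp b} (hA : A * A = 1) (x : V) :
    alphaForm hb A hA x = b x (nilPart A x) := by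
  rw [nilPart_apply, map_add, hb.self_eq_zero, add_zero]
  rfl

theorem alpha_eq_zero_iff [FiniteDimensional (ZMod 2) V] (hb : b.IsAlt) {A : Sp b}
    (hA : A * A = 1) : alpha hb A hA = 0 ↔ ∀ x, b x (nilPart A x) = 0 := by
  rw [alpha, Submodule.finrank_eq_zero, LinearMap.range_eq_bot, LinearMap.ext_iff]
  simp only [alphaForm_apply, LinearMap.zero_apply]

theorem alpha_eq_one_iff [FiniteDimensional (ZMod 2) V] (hb : b.IsAlt) {A : Sp b}
    (hA : A * A = 1) : alpha hb A hA = 1 ↔ ∃ x, b x (nilPart A x) = 1 := by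
  have h1 : alpha hb A hA ≤ 1 := by
    have := Submodule.finrank_le (LinearMap.range (alphaForm hb A hA))
    rwa [Module.finrank_self] at this
  have h2 := alpha_eq_zero_iff hb hA
  constructor
  · intro h
    by_contra! h'
    have := h2.2 fun x => (zmod_two_cases _).resolve_right (h' x)
    omega
  · rintro ⟨x, hx⟩
    have : alpha hb A hA ≠ 0 := fun h => by simp [h2.1 h x] at hx
    omega

theorem dickson_eq (A : Sp b) :
    dickson A = Module.finrank (ZMod 2) (LinearMap.range (nilPart A)) := rfl

/-- The centralizer of an involution `A` is transitive on `ker (A + 1) ∖ im (A + 1)`. -/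
theorem exists_commute_apply_eq [FiniteDimensional (ZMod 2) V] (hnd : b.Nondegenerate)
    (hb : b.IsAlt) {A : Sp b} (hA : A * A = 1) {v w : V}
    (hv : v ∈ LinearMap.ker (nilPart A)) (hv' : v ∉ LinearMap.range (nilPart A))
    (hw : w ∈ LinearMap.ker (nilPart A)) (hw' : w ∉ LinearMap.range (nilPart A)) :
    ∃ B : Sp b, Commute B A ∧ B.1 v = w := by
  -- The radical of `ker N` is `im N`, because `(ker N)^⊥ = im N`.
  have key : ∀ v, v ∉ LinearMap.range (nilPart A) → ∃ x ∈ LinearMap.ker (nilPart A), b v x ≠ 0 := by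
    intro v hv
    by_contra! h
    apply hv
    rw [← (isSqZeroSelfAdj_nilPart hA).orthogonal_ker hnd hb]
    intro x hx
    change b x v = 0
    rw [form_comm hb, h x hx]
  obtain ⟨c, hc, d, hd, h⟩ := exists_transvections_apply_eq hb hv hw (key v hv') (key w hw')
  exact ⟨_, (transvection_commute hb hc).mul_left (transvection_commute hb hd), h⟩

/-! ### Involutions and conjugacy in `G_V` -/

theorem sqForm_apply (q : SemiNorm b) (A : Sp b) (v : V) :
    sqForm q A v = q.toQuad v + q.toQuad (A.1 v) := rfl

theorem pair_mul (q : SemiNorm b) (x y : V × ZMod 2) (A B : Sp b) :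
    pair q x A * pair q y B = pair q (x + actFun q A y) (A * B) := rfl

theorem pair_inj (q : SemiNorm b) {x y : V × ZMod 2} {A B : Sp b} :
    pair q x A = pair q y B ↔ x = y ∧ A = B := by
  constructor
  · intro h
    exact ⟨congrArg (fun g : GV q => g.left.toAdd) h, congrArg (fun g : GV q => g.right) h⟩
  · rintro ⟨rfl, rfl⟩
    rfl

theorem pair_surj (q : SemiNorm b) (g : GV q) : ∃ x A, g = pair q x A :=
  ⟨g.left.toAdd, g.right, rfl⟩

theorem one_eq_pair (q : SemiNorm b) : (1 : GV q) = pair q 0 1 := rfl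

theorem sqForm_eq_zero_of_apply_eq (q : SemiNorm b) {A : Sp b} {v : V} (h : A.1 v = v) :
    sqForm q A v = 0 := by
  rw [sqForm_apply, h, ZModModule.add_self]

/-- The `𝔽₂`-coordinate imposes no condition, since `S A` vanishes on vectors fixed by `A`. -/
theorem pair_mul_self_eq_one_iff (q : SemiNorm b) (x : V × ZMod 2) (A : Sp b) :
    pair q x A * pair q x A = 1 ↔ A * A = 1 ∧ nilPart A x.1 = 0 := by
  rw [pair_mul, one_eq_pair, pair_inj, and_comm, and_congr_right_iff]
  intro _
  rw [nilPart_apply, add_comm (A.1 x.1)]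
  constructor
  · intro h
    exact congrArg Prod.fst h
  · intro h
    refine Prod.ext h ?_
    change x.2 + (sqForm q A x.1 + x.2) = 0
    rw [sqForm_eq_zero_of_apply_eq q ((add_eq_zero_iff_eq_of_char_two _ _).1 h).symm, zero_add,
      ZModModule.add_self]

/-- Conjugation by `((y, s), B)`; the scalar `s` is central and drops out. -/
theorem isConj_pair_iff (q : SemiNorm b) (v v' : V) (t t' : ZMod 2) (A A' : Sp b) :
    IsConj (pair q (v, t) A) (pair q (v', t') A') ↔
      ∃ (B : Sp b) (y : V), B * A = A' * B ∧ v' = B.1 v + nilPart A' y ∧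
        t' = t + sqForm q B v + sqForm q A' y := by
  rw [isConj_iff]
  constructor
  · rintro ⟨c, hc⟩
    obtain ⟨⟨y, s⟩, B, rfl⟩ := pair_surj q c
    rw [mul_inv_eq_iff_eq_mul, pair_mul, pair_mul, pair_inj] at hc
    obtain ⟨h1, h2⟩ := hc
    have h3 : y + B.1 v = v' + A'.1 y := congrArg Prod.fst h1
    have h4 : s + (sqForm q B v + t) = t' + (sqForm q A' y + s) := congrArg Prod.snd h1
    refine ⟨B, y, h2, ?_, ?_⟩
    · rw [nilPart_apply, add_left_comm, add_comm (B.1 v), h3, add_comm v', ← add_assoc,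
        ZModModule.add_self, zero_add]
    · have := ZModModule.add_self (sqForm q A' y)
      linear_combination -h4 - this
  · rintro ⟨B, y, h2, h3, h4⟩
    refine ⟨pair q (y, 0) B, ?_⟩
    rw [mul_inv_eq_iff_eq_mul, pair_mul, pair_mul, pair_inj]
    refine ⟨Prod.ext ?_ ?_, h2⟩
    · change y + B.1 v = v' + A'.1 y
      rw [h3, nilPart_apply, add_comm (A'.1 y), ← add_assoc, add_add_self, add_comm]
    · change 0 + (sqForm q B v + t) = t' + (sqForm q A' y + 0)
      have := ZModModule.add_self (sqForm q A' y)
      linear_combination -h4 - this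

/-- The class of the involution `((v, q(v) + s), A)`. -/
def cls (q : SemiNorm b) (A : Sp b) (v : V) (s : ZMod 2) : ConjClasses (GV q) :=
  ConjClasses.mk (pair q (v, q.toQuad v + s) A)

theorem mk_pair_eq_cls (q : SemiNorm b) (A : Sp b) (v : V) (t : ZMod 2) :
    ConjClasses.mk (pair q (v, t) A) = cls q A v (q.toQuad v + t) := by
  rw [cls, ← add_assoc, ZModModule.add_self, zero_add]

/-- With `N = A' + 1`, `S A' (y) = q(N y) + b(y, N y)`. Also `q(B v + N y) = q(B v) + q(N y)`, as `B
v ∈ ker N` is orthogonal to `im N`. All values of `q` therefore cancel after the shift by `q(v)`. -/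
theorem cls_eq_iff (q : SemiNorm b) {A A' : Sp b} (hA : A * A = 1) {v v' : V}
    (hv : nilPart A v = 0) (s s' : ZMod 2) :
    cls q A v s = cls q A' v' s' ↔
      ∃ (B : Sp b) (y : V), B * A = A' * B ∧ v' = B.1 v + nilPart A' y ∧
        s' = s + b y (nilPart A' y) := by
  rw [cls, cls, ConjClasses.mk_eq_mk_iff_isConj, isConj_pair_iff]
  refine exists_congr fun B => exists_congr fun y => and_congr_right fun h1 =>
    and_congr_right fun h2 => ?_
  have h3 : A' * A' = 1 := by
    have : A' = B * A * B⁻¹ := by rw [h1, mul_inv_cancel_right]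
    rw [this]
    simp only [mul_assoc, inv_mul_cancel_left]
    rw [← mul_assoc A A, hA, one_mul, mul_inv_cancel]
  have h4 : nilPart A' (B.1 v) = 0 := by
    rw [nilPart_eq_zero_iff]
    have : (A' * B).1 v = (B * A).1 v := by rw [h1]
    change A'.1 (B.1 v) = B.1 (A.1 v) at this
    rw [this, (nilPart_eq_zero_iff A v).1 hv]
  have h5 : q.toQuad v' = q.toQuad (B.1 v) + q.toQuad (nilPart A' y) := by
    rw [h2, q.map_add', (isSqZeroSelfAdj_nilPart h3).apply_range_orthogonal_ker h4, add_zero]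
  have h6 : sqForm q A' y = q.toQuad (nilPart A' y) + b y (nilPart A' y) := by
    rw [sqForm_apply, apply_eq_add_nilPart, q.map_add']
    linear_combination ZModModule.add_self (q.toQuad y)
  rw [h5, h6, sqForm_apply]
  have e1 := ZModModule.add_self (q.toQuad v)
  constructor
  · intro h
    linear_combination h + e1
  · intro h
    linear_combination h - e1

theorem mem_classesOver_iff (q : SemiNorm b) {A : Sp b} (hA : A * A = 1)
    (c : ConjClasses (GV q)) :
    c ∈ classesOver q A ↔ ∃ v s, nilPart A v = 0 ∧ c = cls q A v s := by
  constructor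
  · rintro ⟨⟨v, t⟩, h, rfl⟩
    exact ⟨v, _, ((pair_mul_self_eq_one_iff q _ A).1 h).2, mk_pair_eq_cls q A v t⟩
  · rintro ⟨v, s, h, rfl⟩
    exact ⟨_, (pair_mul_self_eq_one_iff q _ A).2 ⟨hA, h⟩, rfl⟩

theorem cls_nilPart (q : SemiNorm b) {A : Sp b} (hA : A * A = 1)
    (y : V) (s : ZMod 2) :
    cls q A (nilPart A y) s = cls q A 0 (s + b y (nilPart A y)) := by
  rw [cls_eq_iff q hA ((isSqZeroSelfAdj_nilPart hA).sqZero y)]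
  exact ⟨1, y, by simp, (ZModModule.add_self _).symm, rfl⟩

/-- Staying at `0` forces `N y = 0`, and then the correction `b(y, N y)` vanishes. -/
theorem cls_zero_injective (q : SemiNorm b) {A : Sp b} (hA : A * A = 1) : Function.Injective (cls q A 0) := by
  intro s s' h
  rw [cls_eq_iff q hA (map_zero _)] at h
  obtain ⟨B, y, _, h1, h2⟩ := h
  rw [map_zero, zero_add] at h1
  rw [h2, ← h1, map_zero, add_zero]

theorem cls_zero_ne (q : SemiNorm b) {A : Sp b} (hA : A * A = 1)
    {w : V} (hw : w ∉ LinearMap.range (nilPart A)) (s s' : ZMod 2) :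
    cls q A 0 s ≠ cls q A w s' := by
  intro h
  rw [cls_eq_iff q hA (map_zero _)] at h
  obtain ⟨B, y, _, h1, h2⟩ := h
  rw [map_zero, zero_add] at h1
  exact hw ⟨y, h1.symm⟩

theorem ncard_classesOver_of_ker_eq_range (q : SemiNorm b) {A : Sp b} (hA : A * A = 1)
    (h : LinearMap.ker (nilPart A) = LinearMap.range (nilPart A)) :
    (classesOver q A).ncard = 2 := by
  have : classesOver q A = {cls q A 0 0, cls q A 0 1} := by
    ext c
    rw [mem_classesOver_iff q hA]
    constructor
    · rintro ⟨v, s, hv, rfl⟩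
      have : v ∈ LinearMap.range (nilPart A) := h ▸ hv
      obtain ⟨y, rfl⟩ := this
      rw [cls_nilPart q hA]
      rcases zmod_two_cases (s + b y (nilPart A y)) with h | h <;> simp [h]
    · rintro (rfl | rfl)
      · exact ⟨0, 0, map_zero _, rfl⟩
      · exact ⟨0, 1, map_zero _, rfl⟩
  rw [this, Set.ncard_pair]
  exact (cls_zero_injective q hA).ne (by decide)

theorem cls_eq_of_notMem_range [FiniteDimensional (ZMod 2) V] (hnd : b.Nondegenerate)
    (hb : b.IsAlt) (q : SemiNorm b) {A : Sp b} (hA : A * A = 1)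
    {v w : V} (hv : v ∈ LinearMap.ker (nilPart A))
    (hv' : v ∉ LinearMap.range (nilPart A)) (hw : w ∈ LinearMap.ker (nilPart A))
    (hw' : w ∉ LinearMap.range (nilPart A)) (s : ZMod 2) : cls q A v s = cls q A w s := by
  obtain ⟨B, h1, h2⟩ := exists_commute_apply_eq hnd hb hA hv hv' hw hw'
  rw [cls_eq_iff q hA hv]
  exact ⟨B, 0, h1, by simp [h2], by simp⟩

theorem ncard_classesOver_of_alpha_eq_zero [FiniteDimensional (ZMod 2) V] (hnd : b.Nondegenerate)
    (hb : b.IsAlt) (q : SemiNorm b) {A : Sp b} (hA : A * A = 1)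
    (h : LinearMap.ker (nilPart A) ≠ LinearMap.range (nilPart A))
    (h0 : ∀ x, b x (nilPart A x) = 0) : (classesOver q A).ncard = 4 := by
  have hN := isSqZeroSelfAdj_nilPart hA
  obtain ⟨w, hw, hw'⟩ := SetLike.exists_of_lt (lt_of_le_of_ne hN.range_le_ker h.symm)
  have h1 : classesOver q A =
      {cls q A 0 0, cls q A 0 1, cls q A w 0, cls q A w 1} := by
    ext c
    rw [mem_classesOver_iff q hA]
    constructor
    · rintro ⟨v, s, hv, rfl⟩
      by_cases hv' : v ∈ LinearMap.range (nilPart A)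
      · obtain ⟨y, rfl⟩ := hv'
        rw [cls_nilPart q hA]
        rcases zmod_two_cases (s + b y (nilPart A y)) with h | h <;> simp [h]
      · rw [cls_eq_of_notMem_range hnd hb q hA hv hv' hw hw']
        rcases zmod_two_cases s with h | h <;> simp [h]
    · rintro (rfl | rfl | rfl | rfl)
      exacts [⟨0, 0, map_zero _, rfl⟩, ⟨0, 1, map_zero _, rfl⟩, ⟨w, 0, hw, rfl⟩, ⟨w, 1, hw, rfl⟩]
  have h2 : cls q A w 0 ≠ cls q A w 1 := by
    rw [Ne, cls_eq_iff q hA hw]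
    rintro ⟨B, y, _, _, h⟩
    simp [h0] at h
  have h3 : cls q A 0 0 ≠ cls q A 0 1 := (cls_zero_injective q hA).ne (by decide)
  have h4 := cls_zero_ne q hA hw'
  rw [h1, Set.ncard_insert_of_notMem (by simp [h3, h4]),
    Set.ncard_insert_of_notMem (by simp [h4]), Set.ncard_pair h2]

theorem ncard_classesOver_of_alpha_eq_one [FiniteDimensional (ZMod 2) V] (hnd : b.Nondegenerate)
    (hb : b.IsAlt) (q : SemiNorm b) {A : Sp b} (hA : A * A = 1)
    (h : LinearMap.ker (nilPart A) ≠ LinearMap.range (nilPart A))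
    (h0 : ∃ x, b x (nilPart A x) = 1) : (classesOver q A).ncard = 3 := by
  have hN := isSqZeroSelfAdj_nilPart hA
  obtain ⟨w, hw, hw'⟩ := SetLike.exists_of_lt (lt_of_le_of_ne hN.range_le_ker h.symm)
  obtain ⟨x, hx⟩ := h0
  -- The centralizer moves `w` to `w + N x` keeping `s`, whereas translation by `N x` makes the same
  -- move and changes `s` by `b(x, N x) = 1`.
  have h2 : cls q A w 1 = cls q A w 0 := by
    have hx' : nilPart A x ∈ LinearMap.range (nilPart A) := ⟨x, rfl⟩
    rw [cls_eq_of_notMem_range hnd hb q hA hw hw'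
      (Submodule.add_mem _ hw (hN.range_le_ker hx'))
      (fun hh => hw' ((Submodule.add_mem_iff_left _ hx').1 hh)), eq_comm, cls_eq_iff q hA hw]
    exact ⟨1, x, by simp, rfl, by simp [hx]⟩
  have h1 : classesOver q A = {cls q A 0 0, cls q A 0 1, cls q A w 0} := by
    ext c
    rw [mem_classesOver_iff q hA]
    constructor
    · rintro ⟨v, s, hv, rfl⟩
      by_cases hv' : v ∈ LinearMap.range (nilPart A)
      · obtain ⟨y, rfl⟩ := hv'
        rw [cls_nilPart q hA]
        rcases zmod_two_cases (s + b y (nilPart A y)) with h | h <;> simp [h]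
      · rw [cls_eq_of_notMem_range hnd hb q hA hv hv' hw hw']
        rcases zmod_two_cases s with h | h <;> simp [h, h2]
    · rintro (rfl | rfl | rfl)
      exacts [⟨0, 0, map_zero _, rfl⟩, ⟨0, 1, map_zero _, rfl⟩, ⟨w, 0, hw, rfl⟩]
  have h3 : cls q A 0 0 ≠ cls q A 0 1 := (cls_zero_injective q hA).ne (by decide)
  have h4 := cls_zero_ne q hA hw'
  rw [h1, Set.ncard_insert_of_notMem (by simp [h3, h4]), Set.ncard_pair (h4 _ _)]

/-! ### Split involutions and the action of `C(A)` on `W ⊕ 𝔽₂` -/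

/-- `S A y` depends only on `(A + 1) y`. -/
theorem sqForm_eq_of_nilPart_eq (q : SemiNorm b) {A : Sp b} {x y : V}
    (h : nilPart A x = nilPart A y) : sqForm q A x = sqForm q A y := by
  rw [← sub_eq_zero, ← map_sub]
  apply sqForm_eq_zero_of_apply_eq
  rw [← nilPart_eq_zero_iff, map_sub, h, sub_self]

theorem nilPart_apply_of_commute {A P : Sp b} (h : P * A = A * P) (x : V) :
    nilPart A (P.1 x) = P.1 (nilPart A x) := by
  rw [nilPart_apply, nilPart_apply, map_add]
  congr 1
  exact congrArg (fun B : Sp b => B.1 x) h.symm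

namespace Splits

variable {A : Sp b} {U W : Submodule (ZMod 2) V} {K : U →ₗ[ZMod 2] U}

theorem nilPart_coe_left (h : Splits A U W K) (u : U) :
    nilPart A (u : V) = ((K + LinearMap.id : U →ₗ[ZMod 2] U) u : U) := by
  rw [nilPart_apply, h.onU]
  rfl

theorem nilPart_coe_right (h : Splits A U W K) (w : W) : nilPart A (w : V) = 0 := by
  rw [nilPart_eq_zero_iff, h.onW]

theorem projection_add (h : Splits A U W K) (v : V) :
    (U.projectionOnto W h.compl v : V) + (W.projectionOnto U h.compl.symm v : V) = v := by
  simp [Submodule.projection_add_projection_eq_self]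

theorem nilPart_projection (h : Splits A U W K) (v : V) :
    nilPart A (U.projectionOnto W h.compl v : V) = nilPart A v := by
  conv_rhs => rw [← h.projection_add v, map_add, h.nilPart_coe_right, add_zero]

/-- `N` kills `W`, so the `U`-component of `v` lies in `ker (K + 1)`, which is `im (K + 1)`. -/
theorem exists_nilPart_eq (h : Splits A U W K) {v : V} (hv : nilPart A v = 0) :
    ∃ u : U, nilPart A (u : V) = (U.projectionOnto W h.compl v : V) := by
  have h1 : U.projectionOnto W h.compl v ∈ LinearMap.ker (K + LinearMap.id) := by
    rw [LinearMap.mem_ker]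
    apply Subtype.ext
    rw [← h.nilPart_coe_left, h.nilPart_projection, hv]
    rfl
  rw [← h.exact] at h1
  obtain ⟨u, hu⟩ := h1
  exact ⟨u, by rw [h.nilPart_coe_left, hu]⟩

theorem nilPart_mem (h : Splits A U W K) (v : V) : nilPart A v ∈ U := by
  rw [← h.nilPart_projection, h.nilPart_coe_left]
  exact Subtype.property _

/-- `W` lies in `ker N` and meets `im N ≤ U` trivially. -/
theorem ker_eq_range_iff (hA : A * A = 1) (h : Splits A U W K) :
    LinearMap.ker (nilPart A) = LinearMap.range (nilPart A) ↔ W = ⊥ := by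
  constructor
  · intro h1
    rw [eq_bot_iff]
    intro w hw
    have : w ∈ LinearMap.range (nilPart A) := h1 ▸ h.nilPart_coe_right ⟨w, hw⟩
    obtain ⟨y, rfl⟩ := this
    exact h.compl.disjoint.le_bot ⟨h.nilPart_mem y, hw⟩
  · rintro rfl
    refine le_antisymm (fun v hv => ?_) (isSqZeroSelfAdj_nilPart hA).range_le_ker
    obtain ⟨u, hu⟩ := h.exists_nilPart_eq hv
    refine ⟨u, hu.trans ?_⟩
    conv_rhs => rw [← h.projection_add v]
    rw [(Submodule.mem_bot (ZMod 2)).1 (Submodule.projectionOnto ⊥ U h.compl.symm v).2, add_zero]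

theorem projectionOnto_eq (h : Splits A U W K) {v : V} {w : W} {y : V}
    (hv : v = w + nilPart A y) : U.projectionOnto W h.compl v = nilPart A y ∧
      W.projectionOnto U h.compl.symm v = w := by
  have hy := h.nilPart_mem y
  subst hv
  rw [map_add, map_add, Submodule.projectionOnto_apply_right, Submodule.projectionOnto_apply_left,
    Submodule.projectionOnto_apply_of_mem_left _ hy,
    Submodule.projectionOnto_apply_of_mem_right _ hy]
  simp

theorem exists_decomposition (h : Splits A U W K) (P : Subgroup.centralizer ({A} : Set (Sp b)))
    (w : W) : ∃ u : U, A.1 (u : V) + (u : V) = (U.projectionOnto W h.compl (P.1.1 (w : V)) : V) := by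
  refine h.exists_nilPart_eq ?_
  rw [nilPart_apply_of_commute (Subgroup.mem_centralizer_singleton_iff.1 P.2), h.nilPart_coe_right,
    map_zero]

/-- The action of `C(A)` on `W ⊕ 𝔽₂`. -/
noncomputable def actW (q : SemiNorm b) (h : Splits A U W K)
    (P : Subgroup.centralizer ({A} : Set (Sp b))) (x : W × ZMod 2) : W × ZMod 2 :=
  (W.projectionOnto U h.compl.symm (P.1.1 (x.1 : V)),
    x.2 + sqForm q P.1 (x.1 : V) + sqForm q A ((h.exists_decomposition P x.1).choose : V))

/-- Frees the action from the chosen `u`: any `y`, even outside `U`, computes it, since `S A y`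
depends only on `N y`. -/
theorem actW_eq (q : SemiNorm b) (h : Splits A U W K)
    (P : Subgroup.centralizer ({A} : Set (Sp b))) {w w' : W} (t : ZMod 2) {y : V}
    (hy : P.1.1 (w : V) = w' + nilPart A y) :
    h.actW q P (w, t) = (w', t + sqForm q P.1 (w : V) + sqForm q A y) := by
  obtain ⟨h1, h2⟩ := h.projectionOnto_eq hy
  have h3 := (h.exists_decomposition P w).choose_spec
  rw [actW, h2, sqForm_eq_of_nilPart_eq q (h3.trans h1)]

theorem apply_eq (h : Splits A U W K) (P : Subgroup.centralizer ({A} : Set (Sp b))) {w : W} {y : V}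
    (hy : nilPart A y = (U.projectionOnto W h.compl (P.1.1 (w : V)) : V)) :
    P.1.1 (w : V) = W.projectionOnto U h.compl.symm (P.1.1 (w : V)) + nilPart A y := by
  conv_lhs => rw [← h.projection_add (P.1.1 (w : V))]
  rw [hy, add_comm]

/-- `C(A)` acts on `W ⊕ 𝔽₂` through `actW`. -/
@[reducible] noncomputable def mulAction (q : SemiNorm b) (h : Splits A U W K) :
    MulAction (Subgroup.centralizer ({A} : Set (Sp b))) (W × ZMod 2) where
  smul := h.actW q
  one_smul := by
    rintro ⟨w, t⟩
    change h.actW q 1 (w, t) = (w, t)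
    rw [h.actW_eq q 1 t (w' := w) (y := 0) (by rw [map_zero, add_zero]; rfl), map_zero]
    change (w, t + sqForm q 1 (w : V) + 0) = _
    rw [sqForm_one, add_zero, add_zero]
  mul_smul := by
    rintro P Q ⟨w, t⟩
    change h.actW q (P * Q) (w, t) = h.actW q P (h.actW q Q (w, t))
    have hP : P.1 * A = A * P.1 := Subgroup.mem_centralizer_singleton_iff.1 P.2
    obtain ⟨u, hu⟩ := h.exists_decomposition Q w
    have h1 := h.apply_eq Q hu
    set w₁ := W.projectionOnto U h.compl.symm (Q.1.1 (w : V))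
    obtain ⟨u', hu'⟩ := h.exists_decomposition P w₁
    have h2 := h.apply_eq P hu'
    set w₂ := W.projectionOnto U h.compl.symm (P.1.1 (w₁ : V))
    -- `P` commutes with `N`, so `P (N u) = N (P u)`. The vector `P u` need not lie in `U`.
    have h3 : (P * Q).1.1 (w : V) = w₂ + nilPart A ((u' : V) + P.1.1 u) := by
      change P.1.1 (Q.1.1 (w : V)) = _
      rw [h1, map_add, h2, map_add, nilPart_apply_of_commute hP, add_assoc]
    rw [h.actW_eq q Q t h1, h.actW_eq q P _ h2, h.actW_eq q (P * Q) t h3]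
    refine Prod.ext rfl ?_
    change t + sqForm q (P.1 * Q.1) (w : V) + _ = t + _ + _ + _ + _
    -- Expanding both sides by the cocycle rule gives `S A (P u) = S A (u) + S P (N u)`, the
    -- identity that makes the scalars agree.
    have h4 : sqForm q (P.1 * A) (u : V) = sqForm q (A * P.1) (u : V) := by rw [hP]
    rw [sqForm_mul, sqForm_mul, apply_eq_add_nilPart, map_add] at h4
    rw [sqForm_mul, h1, map_add, map_add]
    have h5 := ZModModule.add_self (sqForm q A (P.1.1 (u : V)))
    have h6 := ZModModule.add_self (sqForm q A (u : V))
    linear_combination h4 + h5 - h6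

theorem mk_eq_mk_iff (q : SemiNorm b) (h : Splits A U W K) (x y : W × ZMod 2) :
    ConjClasses.mk (pair q ((x.1 : V), x.2) A) = ConjClasses.mk (pair q ((y.1 : V), y.2) A) ↔
      ∃ P, h.actW q P x = y := by
  rw [ConjClasses.mk_eq_mk_iff_isConj, isConj_pair_iff]
  constructor
  · rintro ⟨B, z, h1, h2, h3⟩
    refine ⟨⟨B, Subgroup.mem_centralizer_singleton_iff.2 h1⟩, ?_⟩
    rw [h.actW_eq (y := z) (w' := y.1), ← h3]
    change B.1 (x.1 : V) = _
    rw [h2, add_add_self]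
  · rintro ⟨P, rfl⟩
    obtain ⟨u, hu⟩ := h.exists_decomposition P x.1
    have h1 := h.apply_eq P hu
    rw [h.actW_eq q P x.2 h1]
    refine ⟨P.1, u, Subgroup.mem_centralizer_singleton_iff.1 P.2, ?_, rfl⟩
    conv_rhs => rw [h1, add_add_self]

/-- The orbits of `C(A)` on `W ⊕ 𝔽₂` are the classes over `A`. -/
theorem exists_orbit_equiv (hA : A * A = 1) (q : SemiNorm b) (h : Splits A U W K) :
    ∃ e : Quotient (@MulAction.orbitRel _ (W × ZMod 2) _ (h.mulAction q)) ≃ classesOver q A,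
      ∀ (w : W) (t : ZMod 2), (e (Quotient.mk _ (w, t)) : ConjClasses (GV q)) =
        ConjClasses.mk (pair q ((w : V), t) A) := by
  let _ := h.mulAction q
  have hrel : ∀ x y : W × ZMod 2, MulAction.orbitRel _ _ x y ↔
      ConjClasses.mk (pair q ((x.1 : V), x.2) A) = ConjClasses.mk (pair q ((y.1 : V), y.2) A) :=
    fun x y => by
      rw [eq_comm, h.mk_eq_mk_iff q]
      rfl
  let f : W × ZMod 2 → classesOver q A := fun x =>
    ⟨ConjClasses.mk (pair q ((x.1 : V), x.2) A), _,
      (pair_mul_self_eq_one_iff q _ A).2 ⟨hA, h.nilPart_coe_right x.1⟩, rfl⟩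
  refine ⟨Equiv.ofBijective (Quotient.lift f fun x y hxy => Subtype.ext ((hrel x y).1 hxy))
    ⟨?_, ?_⟩, fun w t => rfl⟩
  · rintro ⟨x⟩ ⟨y⟩ hxy
    exact Quotient.sound ((hrel x y).2 (congrArg Subtype.val hxy))
  · rintro ⟨_, ⟨v, t⟩, h1, rfl⟩
    have hv := ((pair_mul_self_eq_one_iff q _ A).1 h1).2
    obtain ⟨u, hu⟩ := h.exists_nilPart_eq hv
    -- Translation by `N u` removes the `U`-component of `v`, at the cost of the scalar `S A (u)`.
    refine ⟨Quotient.mk _ (W.projectionOnto U h.compl.symm v, t + sqForm q A u),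
      Subtype.ext (ConjClasses.mk_eq_mk_iff_isConj.2 ?_)⟩
    rw [isConj_pair_iff]
    refine ⟨1, u, by simp, ?_, ?_⟩
    · rw [hu, add_comm]
      exact (h.projection_add v).symm
    · rw [sqForm_one, add_zero, add_add_self]

end Splits

/-! ### Isotropic families and Witt's theorem -/

/-- Witt's theorem for totally isotropic families: `Sp(V)` is transitive on linearly independent
totally isotropic families of a given length. -/
theorem exists_apply_eq_of_isotropic [FiniteDimensional (ZMod 2) V] (hnd : b.Nondegenerate)
    (hb : b.IsAlt) {d : ℕ} {a a' : Fin d → V}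
    (ha : LinearIndependent (ZMod 2) a) (ha' : LinearIndependent (ZMod 2) a')
    (h : ∀ i j, b (a i) (a j) = 0) (h' : ∀ i j, b (a' i) (a' j) = 0) :
    ∃ P : Sp b, ∀ i, P.1 (a i) = a' i := by
  induction d with
  | zero => exact ⟨1, fun i => i.elim0⟩
  | succ d ih =>
    rw [linearIndependent_finSucc] at ha'
    obtain ⟨P, hP⟩ := ih (linearIndependent_finSucc.1 ha).1 ha'.1 (fun i j => h _ _)
      (fun i j => h' _ _)
    have hPa : LinearIndependent (ZMod 2) (P.1 ∘ a) := ha.map' P.1.toLinearMap P.1.ker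
    rw [linearIndependent_finSucc, show Fin.tail (P.1 ∘ a) = Fin.tail a' from funext hP] at hPa
    set S := Submodule.span (ZMod 2) (Set.range (Fin.tail a'))
    have hmem : ∀ v, (∀ i, b (Fin.tail a' i) v = 0) → v ∈ b.orthogonal S := by
      intro v hv
      have : S ≤ LinearMap.ker (b.flip v) := by
        rw [Submodule.span_le]
        rintro _ ⟨i, rfl⟩
        exact hv i
      intro x hx
      exact this hx
    -- By `S^⊥⊥ = S`, the heads `P (a 0)` and `a' 0` are outside the radical of `S^⊥`. Transvections
    -- along `S^⊥` then match the heads while fixing the tails, which lie in `S`.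
    have hrad : ∀ v, v ∉ S → ∃ x ∈ b.orthogonal S, b v x ≠ 0 := by
      intro v hv
      by_contra! hx
      apply hv
      rw [← LinearMap.BilinForm.orthogonal_orthogonal hnd hb.isRefl S]
      intro x hx'
      change b x v = 0
      rw [form_comm hb, hx x hx']
    obtain ⟨c, hc, c', hc', hv⟩ := exists_transvections_apply_eq hb
      (hmem (P.1 (a 0)) fun i => by rw [← hP, P.2]; exact h _ _)
      (hmem (a' 0) fun i => h' _ _) (hrad _ hPa.2) (hrad _ ha'.2)
    refine ⟨transvection hb c * transvection hb c' * P, fun i => ?_⟩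
    refine Fin.cases hv (fun i => ?_) i
    have hS : Fin.tail a' i ∈ S := Submodule.subset_span ⟨i, rfl⟩
    change (transvection hb c).1 ((transvection hb c').1 (P.1 (Fin.tail a i))) = Fin.tail a' i
    rw [hP, transvection_apply_of_orthogonal hb (hc' _ hS),
      transvection_apply_of_orthogonal hb (hc _ hS)]

/-- While `S`, the span so far, has dimension below half, `S^⊥` is larger than `S` and supplies the
next vector. -/
theorem exists_isotropic_family [FiniteDimensional (ZMod 2) V] (hnd : b.Nondegenerate)
    (hb : b.IsAlt) {d : ℕ} (hd : 2 * d ≤ Module.finrank (ZMod 2) V) :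
    ∃ a : Fin d → V, LinearIndependent (ZMod 2) a ∧ ∀ i j, b (a i) (a j) = 0 := by
  induction d with
  | zero => exact ⟨Fin.elim0, linearIndependent_empty_type, fun i => i.elim0⟩
  | succ d ih =>
    obtain ⟨a, ha, h⟩ := ih (by omega)
    set S := Submodule.span (ZMod 2) (Set.range a)
    have h1 : Module.finrank (ZMod 2) S = d := by
      simpa using finrank_span_eq_card ha
    have h2 := LinearMap.BilinForm.finrank_orthogonal hnd S
    obtain ⟨v, hv, hv'⟩ : ∃ v ∈ b.orthogonal S, v ∉ S := by
      by_contra! hle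
      have := Submodule.finrank_mono (show b.orthogonal S ≤ S from hle)
      omega
    refine ⟨Fin.cons v a, linearIndependent_finCons.2 ⟨ha, hv'⟩, fun i j => ?_⟩
    have h3 : ∀ i, b (a i) v = 0 := fun i => hv _ (Submodule.subset_span ⟨i, rfl⟩)
    refine Fin.cases ?_ (fun i => ?_) i <;> refine Fin.cases ?_ (fun j => ?_) j
    · exact hb.self_eq_zero v
    · simpa [form_comm hb v] using h3 j
    · simpa using h3 i
    · simpa using h i j

/-- A linearly independent family has a dual family for a nondegenerate form. -/
theorem exists_dual_family [FiniteDimensional (ZMod 2) V] {ι : Type*} [DecidableEq ι]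
    (hnd : b.Nondegenerate)
    {a : ι → V} (ha : LinearIndependent (ZMod 2) a) :
    ∃ x : ι → V, ∀ i j, b (x i) (a j) = if i = j then 1 else 0 := by
  -- `g` extends the coordinates on the span of `a` to all of `V`; the form represents each
  -- coordinate functional by a vector.
  obtain ⟨g, hg⟩ := LinearMap.exists_leftInverse_of_injective
    (Finsupp.linearCombination (ZMod 2) a) (LinearMap.ker_eq_bot.2 ha)
  refine ⟨fun i => (b.toDual hnd).symm (Finsupp.lapply i ∘ₗ g), fun i j => ?_⟩
  rw [LinearMap.BilinForm.apply_toDual_symm_apply]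
  have := LinearMap.congr_fun hg (Finsupp.single j 1)
  simp only [LinearMap.comp_apply, Finsupp.linearCombination_single, one_smul,
    LinearMap.id_apply] at this
  rw [LinearMap.comp_apply, this, Finsupp.lapply_apply, Finsupp.single_apply]
  simp only [eq_comm]

/-! ### Operators attached to a family: `σ = id` is the diagonal shape, `σ = Sum.swap` the
hyperbolic one -/

section gramOp

variable {ι : Type*} [Fintype ι]

/-- The operator `x ↦ ∑ i, b(x, aᵢ) a_{σ i}`. -/
def gramOp (b : LinearMap.BilinForm (ZMod 2) V) (a : ι → V) (σ : ι → ι) : V →ₗ[ZMod 2] V :=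
  ∑ i, (b.flip (a i)).smulRight (a (σ i))

theorem gramOp_apply (a : ι → V) (σ : ι → ι) (x : V) :
    gramOp b a σ x = ∑ i, b x (a i) • a (σ i) := by
  simp [gramOp, LinearMap.sum_apply]

theorem range_gramOp_le (a : ι → V) (σ : ι → ι) :
    LinearMap.range (gramOp b a σ) ≤ Submodule.span (ZMod 2) (Set.range a) := by
  rintro _ ⟨x, rfl⟩
  rw [gramOp_apply]
  exact Submodule.sum_mem _ fun i _ => Submodule.smul_mem _ _ (Submodule.subset_span ⟨_, rfl⟩)

theorem isSqZeroSelfAdj_gramOp (hb : b.IsAlt) {a : ι → V} {σ : ι → ι}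
    (hσ : Function.Involutive σ) (h : ∀ i j, b (a i) (a j) = 0) :
    IsSqZeroSelfAdj b (gramOp b a σ) where
  selfAdj x y := by
    simp only [gramOp_apply, map_sum, map_smul, LinearMap.sum_apply, LinearMap.smul_apply,
      smul_eq_mul]
    refine Fintype.sum_equiv hσ.toPerm _ _ fun i => ?_
    change _ = b y (a (σ i)) * b x (a (σ (σ i)))
    rw [hσ i, form_comm hb y, mul_comm]
  sqZero x := by
    rw [gramOp_apply, gramOp_apply]
    refine Finset.sum_eq_zero fun i _ => ?_
    rw [map_sum, LinearMap.sum_apply, Finset.sum_eq_zero, zero_smul]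
    intro j _
    rw [map_smul, LinearMap.smul_apply, h, smul_zero]

theorem apply_gramOp (P : Sp b) {a a' : ι → V} (h : ∀ i, P.1 (a i) = a' i) (σ : ι → ι) (x : V) :
    P.1 (gramOp b a σ x) = gramOp b a' σ (P.1 x) := by
  simp only [gramOp_apply, map_sum, map_smul, ← h, P.2 x]

theorem gramOp_apply_dual [DecidableEq ι] {a : ι → V} {σ : ι → ι} {x : V} {i : ι}
    (hx : ∀ j, b x (a j) = if i = j then 1 else 0) : gramOp b a σ x = a (σ i) := by
  simp [gramOp_apply, hx]

/-- The vector dual to `a (σ i)` is sent to `a i`, so the range is the whole span. -/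
theorem finrank_range_gramOp [FiniteDimensional (ZMod 2) V] (hnd : b.Nondegenerate)
    {a : ι → V} (ha : LinearIndependent (ZMod 2) a) {σ : ι → ι} (hσ : Function.Involutive σ) :
    Module.finrank (ZMod 2) (LinearMap.range (gramOp b a σ)) = Fintype.card ι := by
  classical
  obtain ⟨x, hx⟩ := exists_dual_family hnd ha
  rw [← finrank_span_eq_card ha, le_antisymm (range_gramOp_le a σ) (Submodule.span_le.2 ?_)]
  rintro _ ⟨i, rfl⟩
  exact ⟨x (σ i), by rw [gramOp_apply_dual (hx (σ i)), hσ i]⟩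

/-- The range lies in the span of `a`, so maximal rank forces independence and equality of the two.
Isotropy follows because `im N ≤ ker N = (im N)^⊥`. -/
theorem linearIndependent_of_card_le_finrank_range [FiniteDimensional (ZMod 2) V]
    {a : ι → V} {σ : ι → ι} (hN : IsSqZeroSelfAdj b (gramOp b a σ))
    (hc : Fintype.card ι ≤ Module.finrank (ZMod 2) (LinearMap.range (gramOp b a σ))) :
    LinearIndependent (ZMod 2) a ∧ ∀ i j, b (a i) (a j) = 0 := by
  have h1 : Module.finrank (ZMod 2) (Submodule.span (ZMod 2) (Set.range a)) ≤ Fintype.card ι :=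
    finrank_range_le_card a
  have h2 := Submodule.finrank_mono (range_gramOp_le (b := b) a σ)
  refine ⟨linearIndependent_iff_card_le_finrank_span.2 (hc.trans h2), fun i j => ?_⟩
  have h3 := Submodule.eq_of_le_of_finrank_le (range_gramOp_le (b := b) a σ) (h1.trans hc)
  have h4 : ∀ i, a i ∈ LinearMap.range (gramOp b a σ) := fun i => by
    rw [h3]
    exact Submodule.subset_span ⟨i, rfl⟩
  obtain ⟨y, hy⟩ := h4 j
  rw [← hy]
  exact hN.apply_range_orthogonal_ker (hN.range_le_ker (h4 i))

/-- Involutions with normal forms of the same shape are conjugate. -/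
theorem exists_conj_of_gramOp [FiniteDimensional (ZMod 2) V] (hnd : b.Nondegenerate)
    (hb : b.IsAlt) {A A' : Sp b} (hA : A * A = 1) (hA' : A' * A' = 1) {a a' : ι → V} {σ : ι → ι}
    (h : nilPart A = gramOp b a σ) (h' : nilPart A' = gramOp b a' σ)
    (hc : dickson A = Fintype.card ι) (hc' : dickson A' = Fintype.card ι) :
    ∃ P : Sp b, P * A = A' * P := by
  rw [dickson_eq] at hc hc'
  have hN := isSqZeroSelfAdj_nilPart hA
  have hN' := isSqZeroSelfAdj_nilPart hA'
  rw [h] at hN hc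
  rw [h'] at hN' hc'
  obtain ⟨h1, h2⟩ := linearIndependent_of_card_le_finrank_range hN hc.ge
  obtain ⟨h1', h2'⟩ := linearIndependent_of_card_le_finrank_range hN' hc'.ge
  let e := (Fintype.equivFin ι).symm
  obtain ⟨P, hP⟩ := exists_apply_eq_of_isotropic hnd hb (h1.comp e e.injective)
    (h1'.comp e e.injective) (fun i j => h2 _ _) (fun i j => h2' _ _)
  have hP' : ∀ i, P.1 (a i) = a' i := fun i => by simpa using hP (e.symm i)
  refine ⟨P, Subtype.ext (LinearEquiv.ext fun x => ?_)⟩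
  change P.1 (A.1 x) = A'.1 (P.1 x)
  rw [apply_eq_add_nilPart A, apply_eq_add_nilPart A', map_add, h, h', apply_gramOp P hP']

end gramOp

/-! ### Normal forms -/

/-- The operator `x ↦ b(x, e) f + b(x, f) e`. -/
def hypOp (b : LinearMap.BilinForm (ZMod 2) V) (e f : V) : V →ₗ[ZMod 2] V :=
  (b.flip e).smulRight f + (b.flip f).smulRight e

theorem hypOp_apply (e f x : V) : hypOp b e f x = b x e • f + b x f • e := rfl

theorem IsSqZeroSelfAdj.add {M N : V →ₗ[ZMod 2] V} (hN : IsSqZeroSelfAdj b N)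
    (hM : ∀ x y, b (M x) y = b x (M y)) (h1 : ∀ x, M (M x) = 0) (h2 : ∀ x, N (M x) = 0)
    (h3 : ∀ x, M (N x) = 0) : IsSqZeroSelfAdj b (N + M) where
  selfAdj x y := by simp [hN.selfAdj, hM]
  sqZero x := by simp [hN.sqZero, h1, h2, h3]

/-- Normal form in the alternating case. -/
theorem exists_hyperbolic_form [FiniteDimensional (ZMod 2) V] (hnd : b.Nondegenerate)
    (hb : b.IsAlt) {N : V →ₗ[ZMod 2] V} (hN : IsSqZeroSelfAdj b N) (h0 : ∀ x, b x (N x) = 0) :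
    ∃ (k : ℕ) (e f : Fin k → V), 2 * k ≤ Module.finrank (ZMod 2) (LinearMap.range N) ∧
      ∀ x, N x = ∑ i, hypOp b (e i) (f i) x := by
  induction hm : Module.finrank (ZMod 2) (LinearMap.range N) using Nat.strong_induction_on
    generalizing N with
  | _ m ih =>
  subst hm
  by_cases hz : N = 0
  · exact ⟨0, Fin.elim0, Fin.elim0, by simp, by simp [hz]⟩
  obtain ⟨y, hy⟩ : ∃ y, N y ≠ 0 := by
    by_contra! h
    exact hz (LinearMap.ext h)
  obtain ⟨z, hz⟩ : ∃ z, b z (N y) ≠ 0 := by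
    by_contra! h
    exact hy (hnd.2 _ h)
  replace hz := (zmod_two_cases _).resolve_left hz
  have hyz : b y (N z) = 1 := by rw [← hN.selfAdj, form_comm hb, hz]
  have hNN : ∀ x x', b (N x) (N x') = 0 := fun x x' => by rw [hN.selfAdj, hN.sqZero, map_zero]
  -- Splitting off the plane of `y, z` for the form `b(x, N x')`: the new operator kills `ker N`,
  -- `y` and `z`, so its rank drops by at least two, as the bound on `2 * k` requires.
  have hN' : IsSqZeroSelfAdj b (N + hypOp b (N y) (N z)) := by
    refine hN.add (fun x x' => ?_) (fun x => ?_) (fun x => ?_) (fun x => ?_)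
    · simp only [hypOp_apply, map_add, map_smul, LinearMap.add_apply, LinearMap.smul_apply,
        smul_eq_mul]
      rw [form_comm hb (N z) x', form_comm hb (N y) x']
      ring
    · simp [hypOp_apply, hNN]
    · simp [hypOp_apply, hN.sqZero]
    · simp [hypOp_apply, hNN]
  have hle : LinearMap.ker N ≤ LinearMap.ker (N + hypOp b (N y) (N z)) := by
    intro x hx
    rw [LinearMap.mem_ker] at hx ⊢
    simp [hypOp_apply, hx, hN.apply_range_orthogonal_ker hx]
  have hy' : y ∈ LinearMap.ker (N + hypOp b (N y) (N z)) := by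
    rw [LinearMap.mem_ker]
    simp [hypOp_apply, h0, hyz, ZModModule.add_self]
  have hz' : z ∈ LinearMap.ker (N + hypOp b (N y) (N z)) := by
    rw [LinearMap.mem_ker]
    simp [hypOp_apply, h0, hz, ZModModule.add_self]
  have hlt1 : LinearMap.ker N < LinearMap.ker N ⊔ Submodule.span (ZMod 2) {y} := by
    refine lt_of_le_not_ge le_sup_left fun h => hy ?_
    exact h (Submodule.mem_sup_right (Submodule.mem_span_singleton_self y))
  have hlt2 : LinearMap.ker N ⊔ Submodule.span (ZMod 2) {y} <
      LinearMap.ker (N + hypOp b (N y) (N z)) := by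
    refine lt_of_le_not_ge (sup_le hle ((Submodule.span_singleton_le_iff_mem _ _).2 hy'))
      fun h => ?_
    obtain ⟨x, hx, w, hw, hxw⟩ := Submodule.mem_sup.1 (h hz')
    obtain ⟨c, rfl⟩ := Submodule.mem_span_singleton.1 hw
    rw [LinearMap.mem_ker] at hx
    have : b y (N z) = 0 := by rw [← hxw]; simp [hx, h0]
    rw [this] at hyz
    exact zero_ne_one hyz
  have hr := Submodule.finrank_lt_finrank_of_lt hlt1
  have hr' := Submodule.finrank_lt_finrank_of_lt hlt2
  have e1 := LinearMap.finrank_range_add_finrank_ker N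
  have e2 := LinearMap.finrank_range_add_finrank_ker (N + hypOp b (N y) (N z))
  obtain ⟨k, e, f, hk, hef⟩ := ih _ (by omega) hN' (fun x => by
    simp only [LinearMap.add_apply, map_add, h0, hypOp_apply, map_smul, smul_eq_mul, zero_add]
    rw [mul_comm, ZModModule.add_self]) rfl
  refine ⟨k + 1, Fin.cons (N y) e, Fin.cons (N z) f, by omega, fun x => ?_⟩
  rw [Fin.sum_univ_succ]
  simp only [Fin.cons_zero, Fin.cons_succ, ← hef, LinearMap.add_apply]
  rw [add_comm, add_add_self]

/-- Diagonalisation of a sum of a nonzero diagonal form and hyperbolic planes. -/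
theorem exists_diagonal_of_add_hyperbolic {k m : ℕ} (a : Fin (k + 1) → V) (e f : Fin m → V) :
    ∃ a' : Fin (k + 2 * m + 1) → V, ∀ x, ∑ i, rankOne b (a' i) x =
      ∑ i, rankOne b (a i) x + ∑ i, hypOp b (e i) (f i) x := by
  induction m generalizing k with
  | zero => exact ⟨a, fun x => by simp⟩
  | succ m ih =>
    -- Over `𝔽₂`, `a² + (ef + fe) = (a+e)² + (a+f)² + (a+e+f)²`: one diagonal term absorbs a plane
    -- and becomes three.
    obtain ⟨a', ha'⟩ := ih (k := k + 2) (Fin.cons (a 0 + e 0) (Fin.cons (a 0 + f 0)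
      (Fin.cons (a 0 + e 0 + f 0) (Fin.tail a)))) (Fin.tail e) (Fin.tail f)
    rw [show k + 2 * (m + 1) + 1 = k + 2 + 2 * m + 1 by ring]
    refine ⟨a', fun x => ?_⟩
    rw [ha', Fin.sum_univ_succ (n := k + 2), Fin.sum_univ_succ (n := k + 1), Fin.sum_univ_succ,
      Fin.sum_univ_succ (n := k), Fin.sum_univ_succ (n := m)]
    simp only [Fin.cons_zero, Fin.cons_succ, Fin.tail, rankOne_apply, hypOp_apply, map_add,
      add_smul, smul_add]
    have h1 := ZModModule.add_self (b x (a 0) • a 0)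
    have h2 := ZModModule.add_self (b x (a 0) • e 0)
    have h3 := ZModModule.add_self (b x (a 0) • f 0)
    have h4 := ZModModule.add_self (b x (e 0) • a 0)
    have h5 := ZModModule.add_self (b x (f 0) • a 0)
    have h6 := ZModModule.add_self (b x (e 0) • e 0)
    have h7 := ZModModule.add_self (b x (f 0) • f 0)
    linear_combination (norm := module) h1 + h2 + h3 + h4 + h5 + h6 + h7

/-- Normal form in the non-alternating case. -/
theorem exists_diagonal_form [FiniteDimensional (ZMod 2) V] (hnd : b.Nondegenerate)
    (hb : b.IsAlt) {N : V →ₗ[ZMod 2] V} (hN : IsSqZeroSelfAdj b N) (h0 : ∃ x, b x (N x) = 1) :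
    ∃ (k : ℕ) (a : Fin (k + 1) → V), k + 1 ≤ Module.finrank (ZMod 2) (LinearMap.range N) ∧
      ∀ x, N x = ∑ i, rankOne b (a i) x := by
  induction hm : Module.finrank (ZMod 2) (LinearMap.range N) using Nat.strong_induction_on
    generalizing N with
  | _ m ih =>
  subst hm
  obtain ⟨y, hy⟩ := h0
  have hNN : ∀ x x', b (N x) (N x') = 0 := fun x x' => by rw [hN.selfAdj, hN.sqZero, map_zero]
  -- Since `b(y, N y) = 1`, the new operator kills `y` in addition to `ker N`, and the rank drops.
  have hN' : IsSqZeroSelfAdj b (N + rankOne b (N y)) := by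
    have h1 := isSqZeroSelfAdj_rankOne hb (N y)
    refine hN.add h1.selfAdj h1.sqZero (fun x => ?_) (fun x => ?_)
    · simp [hN.sqZero]
    · simp [hNN]
  have hlt : LinearMap.ker N < LinearMap.ker (N + rankOne b (N y)) := by
    refine lt_of_le_not_ge (fun x hx => ?_) fun h => ?_
    · rw [LinearMap.mem_ker] at hx ⊢
      simp [hx, hN.apply_range_orthogonal_ker hx]
    · have : y ∈ LinearMap.ker (N + rankOne b (N y)) := by
        rw [LinearMap.mem_ker]
        simp [hy, ZModModule.add_self]
      have := h this
      rw [LinearMap.mem_ker] at this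
      simp [this] at hy
  have hr := Submodule.finrank_lt_finrank_of_lt hlt
  have e1 := LinearMap.finrank_range_add_finrank_ker N
  have e2 := LinearMap.finrank_range_add_finrank_ker (N + rankOne b (N y))
  have hNx : ∀ x, N x = rankOne b (N y) x + (N + rankOne b (N y)) x := fun x => by
    rw [LinearMap.add_apply, add_comm, add_add_self]
  by_cases h1 : ∃ x, b x ((N + rankOne b (N y)) x) = 1
  · obtain ⟨k, a, hk, ha⟩ := ih _ (by omega) hN' h1 rfl
    refine ⟨k + 1, Fin.cons (N y) a, by omega, fun x => ?_⟩
    rw [Fin.sum_univ_succ]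
    simp only [Fin.cons_zero, Fin.cons_succ, ← ha]
    exact hNx x
  -- The remainder is alternating; its planes are absorbed by the diagonal term just split off.
  · obtain ⟨m, e, f, hm, hef⟩ := exists_hyperbolic_form hnd hb hN'
      (fun x => (zmod_two_cases _).resolve_right fun h => h1 ⟨x, h⟩)
    obtain ⟨a, ha⟩ := exists_diagonal_of_add_hyperbolic (b := b) (k := 0) (fun _ => N y) e f
    refine ⟨_, a, by omega, fun x => ?_⟩
    rw [ha, ← hef, hNx x]
    simp

theorem gramOp_swap_apply {k : ℕ} (e f : Fin k → V) (x : V) :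
    gramOp b (Sum.elim e f) Sum.swap x = ∑ i, hypOp b (e i) (f i) x := by
  simp [gramOp_apply, hypOp_apply, Finset.sum_add_distrib]

theorem dickson_eq_of_conj {A A' P : Sp b} (h : P * A = A' * P) : dickson A = dickson A' := by
  have h1 : ∀ x, P.1 (nilPart A x) = nilPart A' (P.1 x) := fun x => by
    rw [nilPart_apply, nilPart_apply, map_add]
    congr 1
    exact congrArg (fun B : Sp b => B.1 x) h
  rw [dickson_eq, dickson_eq]
  have h2 : LinearMap.range (nilPart A') =
      (LinearMap.range (nilPart A)).map P.1.toLinearMap := by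
    ext x
    constructor
    · rintro ⟨y, rfl⟩
      refine ⟨_, ⟨P.1.symm y, rfl⟩, ?_⟩
      change P.1 _ = _
      rw [h1, LinearEquiv.apply_symm_apply]
    · rintro ⟨_, ⟨y, rfl⟩, rfl⟩
      exact ⟨P.1 y, (h1 y).symm⟩
  rw [h2]
  exact (LinearEquiv.finrank_map_eq P.1 _).symm

theorem alpha_eq_of_conj (hb : b.IsAlt) {A A' P : Sp b} (hA : A * A = 1) (hA' : A' * A' = 1)
    (h : P * A = A' * P) : alpha hb A hA = alpha hb A' hA' := by
  have h1 : ∀ x, A'.1 (P.1 x) = P.1 (A.1 x) := fun x =>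
    congrArg (fun B : Sp b => B.1 x) h.symm
  have h2 : alphaForm hb A hA = alphaForm hb A' hA' ∘ₗ P.1.toLinearMap := LinearMap.ext fun x => by
    change b x (A.1 x) = b (P.1 x) (A'.1 (P.1 x))
    rw [h1, P.2]
  rw [alpha, alpha, h2, LinearMap.range_comp_of_range_eq_top _ (LinearEquiv.range P.1)]

/-! ### Classification of the involutions of `Sp(V)` -/

section classification

variable [FiniteDimensional (ZMod 2) V]

/-- The normal form has at most `D` terms, and at least `D` since its vectors span the range. -/
theorem exists_nilPart_eq_gramOp_id (hnd : b.Nondegenerate) (hb : b.IsAlt) {A : Sp b}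
    (hA : A * A = 1) (h : ∃ x, b x (nilPart A x) = 1) :
    ∃ a : Fin (dickson A) → V, nilPart A = gramOp b a id := by
  obtain ⟨k, a, hk, ha⟩ := exists_diagonal_form hnd hb (isSqZeroSelfAdj_nilPart hA) h
  have h1 : nilPart A = gramOp b a id := LinearMap.ext fun x => by
    rw [ha, gramOp_apply]
    rfl
  have h2 := (Submodule.finrank_mono (range_gramOp_le (b := b) a id)).trans (finrank_range_le_card a)
  rw [← h1, Fintype.card_fin, ← dickson_eq] at h2
  rw [← dickson_eq] at hk
  rw [le_antisymm h2 hk]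
  exact ⟨a, h1⟩

theorem exists_nilPart_eq_gramOp_swap (hnd : b.Nondegenerate) (hb : b.IsAlt) {A : Sp b}
    (hA : A * A = 1) (h : ∀ x, b x (nilPart A x) = 0) :
    ∃ (k : ℕ) (a : Fin k ⊕ Fin k → V), dickson A = 2 * k ∧ nilPart A = gramOp b a Sum.swap := by
  obtain ⟨k, e, f, hk, ha⟩ := exists_hyperbolic_form hnd hb (isSqZeroSelfAdj_nilPart hA) h
  have h1 : nilPart A = gramOp b (Sum.elim e f) Sum.swap := LinearMap.ext fun x => by
    rw [ha, gramOp_swap_apply]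
  have h2 := (Submodule.finrank_mono (range_gramOp_le (b := b) (Sum.elim e f) Sum.swap)).trans
    (finrank_range_le_card _)
  rw [← h1, Fintype.card_sum, Fintype.card_fin, ← dickson_eq] at h2
  rw [← dickson_eq] at hk
  exact ⟨k, _, by omega, h1⟩

/-- Involutions of `Sp(V)` with equal `D` and `α` are conjugate. -/
theorem exists_conj (hnd : b.Nondegenerate) (hb : b.IsAlt) {A A' : Sp b} (hA : A * A = 1)
    (hA' : A' * A' = 1) (hD : dickson A = dickson A') (hα : alpha hb A hA = alpha hb A' hA') :
    ∃ P : Sp b, P * A = A' * P := by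
  by_cases h : ∃ x, b x (nilPart A x) = 1
  · have h' := (alpha_eq_one_iff hb hA').1 (hα ▸ (alpha_eq_one_iff hb hA).2 h)
    obtain ⟨a, ha⟩ := exists_nilPart_eq_gramOp_id hnd hb hA h
    obtain ⟨a', ha'⟩ := exists_nilPart_eq_gramOp_id hnd hb hA' h'
    generalize hd : dickson A = d at *
    subst hD
    exact exists_conj_of_gramOp hnd hb hA hA' ha ha' (by rw [hd, Fintype.card_fin])
      (by rw [Fintype.card_fin])
  · replace h : ∀ x, b x (nilPart A x) = 0 := fun x =>
      (zmod_two_cases _).resolve_right fun hx => h ⟨x, hx⟩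
    have h' := (alpha_eq_zero_iff hb hA').1 (hα ▸ (alpha_eq_zero_iff hb hA).2 h)
    obtain ⟨k, a, hk, ha⟩ := exists_nilPart_eq_gramOp_swap hnd hb hA h
    obtain ⟨k', a', hk', ha'⟩ := exists_nilPart_eq_gramOp_swap hnd hb hA' h'
    obtain rfl : k = k' := by omega
    refine exists_conj_of_gramOp hnd hb hA hA' ha ha' ?_ ?_ <;>
      rw [Fintype.card_sum, Fintype.card_fin] <;> omega

theorem exists_involution_of_alpha_eq_one (hnd : b.Nondegenerate) (hb : b.IsAlt) {d : ℕ}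
    (h1 : 1 ≤ d) (hd : 2 * d ≤ Module.finrank (ZMod 2) V) :
    ∃ (A : Sp b) (hA : A * A = 1), dickson A = d ∧ alpha hb A hA = 1 := by
  obtain ⟨a, ha, h⟩ := exists_isotropic_family hnd hb hd
  have hid : Function.Involutive (id : Fin d → Fin d) := fun _ => rfl
  have hN := isSqZeroSelfAdj_gramOp hb hid h
  refine ⟨hN.toSp, hN.toSp_mul_self, ?_, ?_⟩
  · rw [dickson_eq, nilPart_toSp, finrank_range_gramOp hnd ha hid, Fintype.card_fin]
  · obtain ⟨x, hx⟩ := exists_dual_family hnd ha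
    rw [alpha_eq_one_iff, nilPart_toSp]
    refine ⟨x ⟨0, h1⟩, ?_⟩
    rw [gramOp_apply_dual (hx _), id, hx, if_pos rfl]

/-- Pairing the vectors of an isotropic family by `Sum.swap` makes the terms of `b(x, N x)` cancel
in pairs. -/
theorem exists_involution_of_alpha_eq_zero (hnd : b.Nondegenerate) (hb : b.IsAlt) {k : ℕ}
    (hk : 2 * (2 * k) ≤ Module.finrank (ZMod 2) V) :
    ∃ (A : Sp b) (hA : A * A = 1), dickson A = 2 * k ∧ alpha hb A hA = 0 := by
  obtain ⟨a, ha, h⟩ := exists_isotropic_family hnd hb hk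
  let e : Fin k ⊕ Fin k ≃ Fin (2 * k) := finSumFinEquiv.trans (finCongr (by omega))
  have hsw : Function.Involutive (Sum.swap : Fin k ⊕ Fin k → Fin k ⊕ Fin k) := Sum.swap_swap
  have hN := isSqZeroSelfAdj_gramOp hb (a := a ∘ e) hsw fun i j => h _ _
  refine ⟨hN.toSp, hN.toSp_mul_self, ?_, ?_⟩
  · rw [dickson_eq, nilPart_toSp, finrank_range_gramOp hnd (ha.comp e e.injective) hsw,
      Fintype.card_sum, Fintype.card_fin, two_mul]
  · rw [alpha_eq_zero_iff, nilPart_toSp]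
    intro x
    simp only [gramOp_apply, map_add, map_sum, map_smul, Fintype.sum_sum_type, Sum.swap_inl, Sum.swap_inr,
      smul_eq_mul]
    simp only [mul_comm, ZModModule.add_self]

end classification

/-! ### Counting the classes of involutions of `G_V` -/

theorem classesOver_subset_of_conj (q : SemiNorm b) {A A' P : Sp b}
    (h : P * A = A' * P) : classesOver q A ⊆ classesOver q A' := by
  rintro c ⟨⟨v, t⟩, h1, rfl⟩
  have h2 : IsConj (pair q (v, t) A) (pair q (P.1 v, t + sqForm q P v) A') :=
    (isConj_pair_iff q _ _ _ _ _ _).2 ⟨P, 0, h, by simp, by simp⟩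
  refine ⟨_, ?_, (ConjClasses.mk_eq_mk_iff_isConj.2 h2).symm⟩
  obtain ⟨g, hg⟩ := isConj_iff.1 h2
  rw [← hg]
  calc _ = g * (pair q (v, t) A * pair q (v, t) A) * g⁻¹ := by group
    _ = 1 := by rw [h1, mul_one, mul_inv_cancel]

theorem conj_of_mem_classesOver (q : SemiNorm b) {A A' : Sp b} {c : ConjClasses (GV q)}
    (h : c ∈ classesOver q A) (h' : c ∈ classesOver q A') : ∃ P : Sp b, P * A = A' * P := by
  obtain ⟨⟨v, t⟩, _, rfl⟩ := h
  obtain ⟨⟨v', t'⟩, _, h2⟩ := h'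
  obtain ⟨P, y, h3, _⟩ :=
    (isConj_pair_iff q _ _ _ _ _ _).1 (ConjClasses.mk_eq_mk_iff_isConj.1 h2.symm)
  exact ⟨P, h3⟩

theorem finite_GV [FiniteDimensional (ZMod 2) V] (q : SemiNorm b) : Finite (GV q) := by
  have : Finite V := Module.finite_of_finite (ZMod 2)
  have : Finite (V ≃ₗ[ZMod 2] V) := Finite.of_injective (fun e => (e : V → V)) DFunLike.coe_injective
  have : Finite (Multiplicative (V × ZMod 2)) := inferInstanceAs (Finite (V × ZMod 2))
  exact Finite.of_equiv _ SemidirectProduct.equivProd.symm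

theorem sum_fin_ite_succ_eq {n : ℕ} (hn : 1 ≤ n) :
    ∑ i : Fin n, (if (i : ℕ) + 1 = n then 2 else 3) = 3 * n - 1 := by
  obtain ⟨m, rfl⟩ := Nat.exists_eq_add_of_le' hn
  rw [Fin.sum_univ_castSucc, Finset.sum_congr rfl fun i _ => if_neg (by
    rw [Fin.val_castSucc]; omega)]
  simp only [Finset.sum_const, Finset.card_univ, Fintype.card_fin, smul_eq_mul, Fin.val_last,
    if_true]
  omega

/-- Only the last index can satisfy `2 * i = n`, and it does so iff `n` is even; the total is the
same in both parities. -/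
theorem sum_fin_ite_two_mul_eq (n : ℕ) :
    ∑ i : Fin (n / 2 + 1), (if 2 * (i : ℕ) = n then 2 else 4) = 2 * n + 2 := by
  rw [Fin.sum_univ_castSucc, Finset.sum_congr rfl fun i _ => if_neg (by
    rw [Fin.val_castSucc]; omega)]
  simp only [Finset.sum_const, Finset.card_univ, Fintype.card_fin, smul_eq_mul, Fin.val_last]
  split_ifs <;> omega

section counts

variable [FiniteDimensional (ZMod 2) V]

theorem ncard_classesOver_of_two_mul_dickson_eq (q : SemiNorm b) {A : Sp b} (hA : A * A = 1)
    (h : 2 * dickson A = Module.finrank (ZMod 2) V) : (classesOver q A).ncard = 2 :=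
  ncard_classesOver_of_ker_eq_range q hA
    ((isSqZeroSelfAdj_nilPart hA).two_mul_finrank_range_eq_iff.1 h)

theorem ncard_classesOver_of_two_mul_dickson_lt (hnd : b.Nondegenerate) (hb : b.IsAlt)
    (q : SemiNorm b) {A : Sp b} (hA : A * A = 1)
    (h : 2 * dickson A < Module.finrank (ZMod 2) V) :
    (alpha hb A hA = 0 → (classesOver q A).ncard = 4) ∧
      (alpha hb A hA = 1 → (classesOver q A).ncard = 3) := by
  have h1 : LinearMap.ker (nilPart A) ≠ LinearMap.range (nilPart A) := fun h1 =>
    h.ne ((isSqZeroSelfAdj_nilPart hA).two_mul_finrank_range_eq_iff.2 h1)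
  exact ⟨fun h0 => ncard_classesOver_of_alpha_eq_zero hnd hb q hA h1 ((alpha_eq_zero_iff hb hA).1 h0),
    fun h0 => ncard_classesOver_of_alpha_eq_one hnd hb q hA h1 ((alpha_eq_one_iff hb hA).1 h0)⟩

/-- The number of classes of involutions of `G_V`. -/
theorem ncard_involutionClasses (hnd : b.Nondegenerate) (hb : b.IsAlt) (q : SemiNorm b) {n : ℕ}
    (hn : 1 ≤ n) (hV : Module.finrank (ZMod 2) V = 2 * n) :
    (involutionClasses (GV q)).ncard = 5 * n + 1 := by
  have hfin := finite_GV q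
  have : Finite (ConjClasses (GV q)) := inferInstanceAs (Finite (Quotient _))
  -- One representative per type: `D = i + 1` when `α = 1` (which excludes `D = 0`), and `D = 2 * i`
  -- when `α = 0`, the identity being `i = 0`.
  choose A₁ hA₁ hD₁ hα₁ using fun i : Fin n =>
    exists_involution_of_alpha_eq_one hnd hb (d := i + 1) (by omega) (by omega)
  choose A₀ hA₀ hD₀ hα₀ using fun i : Fin (n / 2 + 1) =>
    exists_involution_of_alpha_eq_zero hnd hb (k := i) (by omega)
  let A : Fin n ⊕ Fin (n / 2 + 1) → Sp b := Sum.elim A₁ A₀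
  have hA : ∀ i, A i * A i = 1 := by
    rintro (i | i)
    exacts [hA₁ i, hA₀ i]
  have hcover : involutionClasses (GV q) = ⋃ i, classesOver q (A i) := by
    ext c
    rw [Set.mem_iUnion]
    constructor
    · rintro ⟨g, hg, rfl⟩
      obtain ⟨x, B, rfl⟩ := pair_surj q g
      have hB := ((pair_mul_self_eq_one_iff q x B).1 hg).1
      have hle := (isSqZeroSelfAdj_nilPart hB).two_mul_finrank_range_le
      rw [← dickson_eq, hV] at hle
      suffices h : ∃ i, ∃ P : Sp b, P * B = A i * P by
        obtain ⟨i, P, hP⟩ := h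
        exact ⟨i, classesOver_subset_of_conj q hP ⟨x, hg, rfl⟩⟩
      by_cases h : ∃ x, b x (nilPart B x) = 1
      · have hpos : dickson B ≠ 0 := fun h0 => by
          rw [dickson_eq, Submodule.finrank_eq_zero, LinearMap.range_eq_bot] at h0
          simp [h0] at h
        refine ⟨Sum.inl ⟨dickson B - 1, by omega⟩, exists_conj hnd hb hB (hA₁ _) ?_ ?_⟩
        · have hB1 : dickson B = dickson B - 1 + 1 := by omega
          exact hB1.trans (hD₁ ⟨dickson B - 1, by omega⟩).symm
        · exact ((alpha_eq_one_iff hb hB).2 h).trans (hα₁ _).symm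
      · replace h : ∀ x, b x (nilPart B x) = 0 := fun x =>
          (zmod_two_cases _).resolve_right fun hx => h ⟨x, hx⟩
        obtain ⟨k, _, hk, _⟩ := exists_nilPart_eq_gramOp_swap hnd hb hB h
        refine ⟨Sum.inr ⟨k, by omega⟩, exists_conj hnd hb hB (hA₀ _) ?_ ?_⟩
        · exact hk.trans (hD₀ ⟨k, by omega⟩).symm
        · exact ((alpha_eq_zero_iff hb hB).2 h).trans (hα₀ _).symm
    · rintro ⟨i, x, hx, rfl⟩
      exact ⟨_, hx, rfl⟩
  have hdisj : Pairwise (Function.onFun Disjoint fun i => classesOver q (A i)) := by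
    intro i j hij
    rw [Function.onFun, Set.disjoint_left]
    intro c hi hj
    obtain ⟨P, hP⟩ := conj_of_mem_classesOver q hi hj
    have h1 := dickson_eq_of_conj hP
    have h2 := alpha_eq_of_conj hb (hA i) (hA j) hP
    apply hij
    rcases i with i | i <;> rcases j with j | j
    · rw [show dickson (A (Sum.inl i)) = _ from hD₁ i,
        show dickson (A (Sum.inl j)) = _ from hD₁ j] at h1
      exact congrArg Sum.inl (Fin.ext (by omega))
    · rw [show alpha hb (A (Sum.inl i)) _ = _ from hα₁ i,
        show alpha hb (A (Sum.inr j)) _ = _ from hα₀ j] at h2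
      omega
    · rw [show alpha hb (A (Sum.inr i)) _ = _ from hα₀ i,
        show alpha hb (A (Sum.inl j)) _ = _ from hα₁ j] at h2
      omega
    · rw [show dickson (A (Sum.inr i)) = _ from hD₀ i,
        show dickson (A (Sum.inr j)) = _ from hD₀ j] at h1
      exact congrArg Sum.inr (Fin.ext (by omega))
  have hc₁ : ∀ i, (classesOver q (A₁ i)).ncard = if (i : ℕ) + 1 = n then 2 else 3 := by
    intro i
    have := hD₁ i
    split_ifs with h
    · exact ncard_classesOver_of_two_mul_dickson_eq q (hA₁ i) (by omega)
    · exact (ncard_classesOver_of_two_mul_dickson_lt hnd hb q (hA₁ i) (by omega)).2 (hα₁ i)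
  have hc₀ : ∀ i, (classesOver q (A₀ i)).ncard = if 2 * (i : ℕ) = n then 2 else 4 := by
    intro i
    have := hD₀ i
    split_ifs with h
    · exact ncard_classesOver_of_two_mul_dickson_eq q (hA₀ i) (by omega)
    · exact (ncard_classesOver_of_two_mul_dickson_lt hnd hb q (hA₀ i) (by omega)).1 (hα₀ i)
  rw [hcover, Set.ncard_iUnion_of_finite (fun _ => Set.toFinite _) hdisj,
    finsum_eq_sum_of_fintype, Fintype.sum_sum_type]
  simp only [A, Sum.elim_inl, Sum.elim_inr, hc₁, hc₀]
  rw [sum_fin_ite_succ_eq hn, sum_fin_ite_two_mul_eq]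
  omega

end counts

end SympInv

open SympInv
theorem mainTheorem3 {V : Type*} [AddCommGroup V] [Module (ZMod 2) V]
    [FiniteDimensional (ZMod 2) V] (b : LinearMap.BilinForm (ZMod 2) V)
    (hnd : b.Nondegenerate) (hb : b.IsAlt) (q : SemiNorm b)
    (n : ℕ) (hn : 1 ≤ n) (hV : Module.finrank (ZMod 2) V = 2 * n) :
    -- involutions that split as `K ⊕ Id_W`
    (∀ (A : Sp b) (hA : A * A = 1) (U W : Submodule (ZMod 2) V) (K : U →ₗ[ZMod 2] U)
        (h : Splits A U W K),
      -- the action of `C(A)` on `W ⊕ 𝔽₂` and its orbits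
      (∃ act : MulAction (Subgroup.centralizer ({A} : Set (Sp b))) (W × ZMod 2),
        (∀ (P : Subgroup.centralizer ({A} : Set (Sp b))) (w : W), ∃ u : U,
          A.1 (u : V) + (u : V) = (U.projectionOnto W h.compl (P.1.1 (w : V)) : V)) ∧
        (∀ (P : Subgroup.centralizer ({A} : Set (Sp b))) (w : W) (t : ZMod 2) (u : U),
          A.1 (u : V) + (u : V) = (U.projectionOnto W h.compl (P.1.1 (w : V)) : V) →
          act.smul P (w, t) =
            (W.projectionOnto U h.compl.symm (P.1.1 (w : V)),
              t + sqForm q P.1 (w : V) + sqForm q A (u : V))) ∧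
        ∃ e : Quotient (@MulAction.orbitRel _ (W × ZMod 2) _ act) ≃ classesOver q A,
          ∀ (w : W) (t : ZMod 2),
            (e (Quotient.mk _ (w, t)) : ConjClasses (GV q)) =
              ConjClasses.mk (pair q ((w : V), t) A)) ∧
      (W = ⊥ → (classesOver q A).ncard = 2) ∧
      (W ≠ ⊥ → alpha hb A hA = 0 → (classesOver q A).ncard = 4) ∧
      (W ≠ ⊥ → alpha hb A hA = 1 →
        (∃ u₁ u₂ : U, K u₁ = u₂ ∧ b (u₁ : V) (u₂ : V) = 1) →
        (classesOver q A).ncard = 3)) ∧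
    -- the number of classes over an arbitrary involution of `Sp(V)`
    (∀ (A : Sp b) (hA : A * A = 1),
      (A = 1 → (classesOver q A).ncard = 4) ∧
      (2 * dickson A = Module.finrank (ZMod 2) V → (classesOver q A).ncard = 2) ∧
      (alpha hb A hA = 1 → 0 < dickson A → 2 * dickson A < Module.finrank (ZMod 2) V →
        (classesOver q A).ncard = 3) ∧
      (alpha hb A hA = 0 → 0 < dickson A → 2 * dickson A < Module.finrank (ZMod 2) V →
        (classesOver q A).ncard = 4)) ∧
    -- the total count
    (involutionClasses (GV q)).ncard = 5 * n + 1 := by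
  refine ⟨fun A hA U W K h => ⟨⟨h.mulAction q, h.exists_decomposition, fun P w t u hu =>
      h.actW_eq q P t (h.apply_eq P hu), h.exists_orbit_equiv hA q⟩, fun hW => ?_, fun hW h0 => ?_,
      fun hW h1 _ => ?_⟩, fun A hA => ⟨?_, ?_, ?_, ?_⟩, ncard_involutionClasses hnd hb q hn hV⟩
  · exact ncard_classesOver_of_ker_eq_range q hA ((h.ker_eq_range_iff hA).2 hW)
  · exact ncard_classesOver_of_alpha_eq_zero hnd hb q hA (mt (h.ker_eq_range_iff hA).1 hW)
      ((alpha_eq_zero_iff hb hA).1 h0)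
  · exact ncard_classesOver_of_alpha_eq_one hnd hb q hA (mt (h.ker_eq_range_iff hA).1 hW)
      ((alpha_eq_one_iff hb hA).1 h1)
  · rintro rfl
    have h0 : nilPart (1 : Sp b) = 0 := LinearMap.ext fun x => ZModModule.add_self x
    refine (ncard_classesOver_of_two_mul_dickson_lt hnd hb q hA ?_).1
      ((alpha_eq_zero_iff hb hA).2 (by simp [h0]))
    rw [dickson_eq, h0, LinearMap.range_zero, finrank_bot]
    omega
  · exact ncard_classesOver_of_two_mul_dickson_eq q hA
  · exact fun h1 _ h => (ncard_classesOver_of_two_mul_dickson_lt hnd hb q hA h).2 h1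
  · exact fun h0 _ h => (ncard_classesOver_of_two_mul_dickson_lt hnd hb q hA h).1 h0
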